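/- Let $\alpha>0$ and let $X_{0,\alpha}:=L^1\big((0,\infty);(1+x)^\alpha dx\big)$ (real or complex). Let $r\in C(0,\infty)$ with $r(x)>0$ for all $x>0$, $$\int_0^1\frac{d\tau}{r(\tau)}<+\infty,\qquad \int_1^\infty\frac{d\tau}{r(\tau)}=+\infty,\qquad r(z)\le C(1+z)\quad(z>0)$$ for some constant $C>0$. Let $0\le a\in L^1_{loc}(0,\infty)$ and let $b\ge 0$ be a measurable function on $(0,\infty)^2$ with $b(x,y)=0$ for $x\ge y$ and $\int_0^y x\,b(x,y)\,dx=y$ for all $y>0$. For $y,t$ with $t\ge 0$ and $\int_0^y\frac{d\tau}{r(\tau)}>t$ let $X(y,t)\in(0,y]$ be defined by $\int_{X(y,t)}^y\frac{d\tau}{r(\tau)}=t$. Then $$(U(t)f)(y)=\chi_{\{\int_0^y\frac{d\tau}{r(\tau)}>t\}}\;e^{-\int_{X(y,t)}^y\frac{a(p)}{r(p)}dp}\;\frac{r(X(y,t))\,f(X(y,t))}{r(y)}$$ defines a $C_0$-semigroup $(U(t))_{t\ge0}$ on $X_{0,\alpha}$; let $T$ be its generator. Let $B$ be the fragmentation operator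 in $X_{0,\alpha}$, $$(B\varphi)(x)=\int_x^\infty a(y)\,b(x,y)\,\varphi(y)\,dy,$$ and put $n_{1,\alpha}(y):=\int_0^y(1+x)^\alpha b(x,y)\,dx$. Suppose that $$\sup_{y>0}\frac{n_{1,\alpha}(y)}{(1+y)^\alpha}<+\infty .$$ Then: 1. $B$ is $T$-bounded in $X_{0,\alpha}$: $B\varphi$ is defined and belongs to $X_{0,\alpha}$ for every $\varphi\in D(T)$, and there are constants $c_1,c_2\ge 0$ with $\|B\varphi\|\le c_1\|T\varphi\|+c_2\|\varphi\|$ for all $\varphi\in D(T)$. 2. For all sufficiently large real $\lambda$, $(\lambda-T)^{-1}$ exists as a bounded operator on $X_{0,\alpha}$ and $B(\lambda-T)^{-1}$ is bounded on $X_{0,\alpha}$; the limit of $\|B(\lambda-T)^{-1}\|_{\mathcal L(X_{0,\alpha})}$ as $\lambda\to+\infty$ exists, and $$\lim_{\lambda\to+\infty}\big\|B(\lambda-T)^{-1}\big\|_{\mathcal L(X_{0,\alpha})}\le\limsup_{a(y)\to+\infty}\frac{n_{1,\alpha}(y)}{(1+y)^\alpha}:=\inf_{c>0}\ \sup_{y>0,\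 a(y)\ge c}\frac{n_{1,\alpha}(y)}{(1+y)^\alpha}\qquad(\sup\emptyset:=0).$$ 3. If $\displaystyle\limsup_{a(y)\to+\infty}\frac{n_{1,\alpha}(y)}{(1+y)^\alpha}<1$, then $A:=T+B$ with domain $D(A)=D(T)$ generates a positive $C_0$-semigroup $(V(t))_{t\ge0}$ on $X_{0,\alpha}$. -/

import Mathlib

open MeasureTheory Filter Set Topology
open scoped NNReal ENNReal

noncomputable section

namespace GrowthFrag

section Abstract

variable {𝕜 E : Type*} [RCLike 𝕜] [NormedAddCommGroup E] [NormedSpace 𝕜 E]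

/-- Strongly continuous one-parameter semigroups of bounded operators (`C₀`-semigroups). -/
structure C0Semigroup (𝕜 E : Type*) [RCLike 𝕜] [NormedAddCommGroup E] [NormedSpace 𝕜 E] where
  /-- The operator at time `t`. -/
  op : ℝ≥0 → E →L[𝕜] E
  op_zero : op 0 = ContinuousLinearMap.id 𝕜 E
  op_add : ∀ s t : ℝ≥0, op (s + t) = (op s).comp (op t)
  continuous_orbit : ∀ f : E, Continuous fun t : ℝ≥0 => op t f

/-- The difference quotient `(S(h) f - f) / h`. -/
def C0Semigroup.quotient (S : C0Semigroup 𝕜 E) (f : E) (h : ℝ≥0) : E :=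
  (((h : ℝ)⁻¹ : ℝ) : 𝕜) • (S.op h f - f)

/-- `g` is the derivative at `0` of the orbit of `f`. -/
def C0Semigroup.HasGenerator (S : C0Semigroup 𝕜 E) (f g : E) : Prop :=
  Tendsto (S.quotient f) (𝓝[>] (0 : ℝ≥0)) (𝓝 g)

theorem C0Semigroup.HasGenerator.add {S : C0Semigroup 𝕜 E} {f g f' g' : E}
    (h : S.HasGenerator f g) (h' : S.HasGenerator f' g') :
    S.HasGenerator (f + f') (g + g') := by
  refine (Tendsto.add h h').congr fun t => ?_
  simp only [C0Semigroup.quotient, map_add, ← smul_add]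
  congr 1
  abel

theorem C0Semigroup.HasGenerator.smul {S : C0Semigroup 𝕜 E} {f g : E} (c : 𝕜)
    (h : S.HasGenerator f g) : S.HasGenerator (c • f) (c • g) := by
  refine (Tendsto.const_smul h c).congr fun t => ?_
  simp only [C0Semigroup.quotient, map_smul, ← smul_sub]
  rw [smul_comm]

theorem C0Semigroup.HasGenerator.unique {S : C0Semigroup 𝕜 E} {f g g' : E}
    (h : S.HasGenerator f g) (h' : S.HasGenerator f g') : g = g' := by
  exact tendsto_nhds_unique h h'

/-- The (infinitesimal) generator of a `C₀`-semigroup, an unbounded operator whose domain is the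
set of all `f` for which `(S(h) f - f) / h` converges in norm as `h → 0+`. -/
def C0Semigroup.generator (S : C0Semigroup 𝕜 E) : E →ₗ.[𝕜] E where
  domain :=
    { carrier := {f | ∃ g, S.HasGenerator f g}
      add_mem' := fun ⟨g, hg⟩ ⟨g', hg'⟩ => ⟨g + g', hg.add hg'⟩
      zero_mem' := ⟨0, by
        simp only [C0Semigroup.HasGenerator]
        refine tendsto_const_nhds.congr fun t => ?_
        simp [C0Semigroup.quotient]⟩
      smul_mem' := fun c _ ⟨g, hg⟩ => ⟨c • g, hg.smul c⟩ }
  toFun :=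
    { toFun := fun f => f.2.choose
      map_add' := fun f f' =>
        (f + f').2.choose_spec.unique (f.2.choose_spec.add f'.2.choose_spec)
      map_smul' := fun c f => (c • f).2.choose_spec.unique (f.2.choose_spec.smul c) }

/-- `R` is the bounded inverse `(z - T)⁻¹` of `z - T : D(T) → E`. -/
def IsResolventAt (T : E →ₗ.[𝕜] E) (z : 𝕜) (R : E →L[𝕜] E) : Prop :=
  (∀ f : E, ∃ h : R f ∈ T.domain, z • R f - T ⟨R f, h⟩ = f) ∧
    ∀ φ : T.domain, R (z • (φ : E) - T φ) = φ

/-- `B` is `T`-bounded: `D(T) ⊆ D(B)` and `‖B φ‖ ≤ c₁ ‖T φ‖ + c₂ ‖φ‖` for all `φ ∈ D(T)`. -/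
def IsRelativelyBounded (T B : E →ₗ.[𝕜] E) : Prop :=
  ∃ hdom : T.domain ≤ B.domain, ∃ c₁ c₂ : ℝ, 0 ≤ c₁ ∧ 0 ≤ c₂ ∧
    ∀ φ : T.domain, ‖B ⟨φ, hdom φ.2⟩‖ ≤ c₁ * ‖T φ‖ + c₂ * ‖(φ : E)‖

end Abstract

/-- The measure `(1 + x)^α dx` on `(0, ∞)`. -/
def weight (α : ℝ) : Measure ℝ :=
  (volume.restrict (Ioi (0 : ℝ))).withDensity fun x => ENNReal.ofReal ((1 + x) ^ α)

/-- The moment space `L¹((0, ∞); (1 + x)^α dx)` of `𝕜`-valued functions, `𝕜 = ℝ` or `ℂ`. -/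
abbrev X₀ (𝕜 : Type*) [RCLike 𝕜] (α : ℝ) : Type _ := Lp 𝕜 1 (weight α)

/-- `f ≥ 0` almost everywhere: almost every value is equal to its own modulus. -/
def IsNonneg {𝕜 : Type*} [RCLike 𝕜] {α : ℝ} (f : X₀ 𝕜 α) : Prop :=
  ∀ᵐ x ∂(weight α), f x = ((‖f x‖ : ℝ) : 𝕜)

/-- A semigroup is positive if all its operators preserve nonnegative functions. -/
def IsPositive {𝕜 : Type*} [RCLike 𝕜] {α : ℝ} (S : C0Semigroup 𝕜 (X₀ 𝕜 α)) : Prop :=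
  ∀ (t : ℝ≥0) (f : X₀ 𝕜 α), IsNonneg f → IsNonneg (S.op t f)

/-- `x = X(y, t)` is the foot of the characteristic of `∂ₜ + ∂ₓ(r ·)` which is at `y` at time `t`:
`0 < x ≤ y` and `∫_x^y dτ / r(τ) = t`. -/
def IsFoot (r : ℝ → ℝ) (y t x : ℝ) : Prop :=
  x ∈ Ioc 0 y ∧ ∫ τ in x..y, 1 / r τ = t

/-- `g = U(t) f`, where, with `X = X(y, t)`,
`(U(t) f)(y) = 1_{∫_0^y 1/r > t} exp(-∫_X^y a/r) r(X) f(X) / r(y)` for almost every `y > 0`. -/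
def IsTransported {𝕜 : Type*} [RCLike 𝕜] (r a : ℝ → ℝ) (t : ℝ) (f g : ℝ → 𝕜) : Prop :=
  ∀ᵐ y ∂(volume.restrict (Ioi (0 : ℝ))),
    (t < ∫ τ in (0 : ℝ)..y, 1 / r τ →
      ∃ x, IsFoot r y t x ∧
        g y = ((Real.exp (-∫ p in x..y, a p / r p) * (r x / r y) : ℝ) : 𝕜) * f x) ∧
    (∫ τ in (0 : ℝ)..y, 1 / r τ ≤ t → g y = 0)

/-- The integrand `y ↦ a(y) b(x, y) φ(y)` of the fragmentation operator. -/
def fragIntegrand {𝕜 : Type*} [RCLike 𝕜] (a : ℝ → ℝ) (b : ℝ → ℝ → ℝ) (φ : ℝ → 𝕜) (x y : ℝ) : 𝕜 :=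
  ((a y * b x y : ℝ) : 𝕜) * φ y

/-- `(B φ)(x) = ∫_x^∞ a(y) b(x, y) φ(y) dy`. -/
def fragIntegral {𝕜 : Type*} [RCLike 𝕜] (a : ℝ → ℝ) (b : ℝ → ℝ → ℝ) (φ : ℝ → 𝕜) (x : ℝ) : 𝕜 :=
  ∫ y in Ioi x, fragIntegrand a b φ x y

/-- The integral defining `B φ` converges absolutely at almost every `x > 0`, and `B φ` is in the
moment space. -/
def InFragDomain {𝕜 : Type*} [RCLike 𝕜] (a : ℝ → ℝ) (b : ℝ → ℝ → ℝ) (α : ℝ) (φ : ℝ → 𝕜) : Prop :=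
  (∀ᵐ x ∂(weight α), IntegrableOn (fragIntegrand a b φ x) (Ioi x)) ∧
    MemLp (fragIntegral a b φ) 1 (weight α)

theorem ae_volume_of_ae_weight {α : ℝ} {p : ℝ → Prop} (h : ∀ᵐ x ∂(weight α), p x) :
    ∀ᵐ x ∂(volume.restrict (Ioi (0 : ℝ))), p x := by
  have hm : Measurable fun x : ℝ => ENNReal.ofReal ((1 + x) ^ α) := by fun_prop
  rw [weight, ae_withDensity_iff hm] at h
  filter_upwards [h, ae_restrict_mem measurableSet_Ioi] with x hx hx0
  refine hx ?_
  have : (0 : ℝ) < 1 + x := by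
    have : (0 : ℝ) < x := hx0
    linarith
  simpa using Real.rpow_pos_of_pos this α

theorem ae_weight_pos (α : ℝ) : ∀ᵐ x ∂(weight α), 0 < x :=
  (withDensity_absolutelyContinuous _ _) (ae_restrict_mem measurableSet_Ioi)

section Frag

variable {𝕜 : Type*} [RCLike 𝕜] {a : ℝ → ℝ} {b : ℝ → ℝ → ℝ} {α : ℝ}

theorem fragIntegrand_congr {φ ψ : ℝ → 𝕜} (h : φ =ᵐ[weight α] ψ) {x : ℝ} (hx : 0 < x) :
    fragIntegrand a b φ x =ᵐ[volume.restrict (Ioi x)] fragIntegrand a b ψ x := by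
  have h1 : ∀ᵐ y ∂(volume.restrict (Ioi x)), φ y = ψ y :=
    ae_restrict_of_ae_restrict_of_subset (Ioi_subset_Ioi hx.le) (ae_volume_of_ae_weight h)
  filter_upwards [h1] with y hy
  simp [fragIntegrand, hy]

theorem fragIntegral_congr {φ ψ : ℝ → 𝕜} (h : φ =ᵐ[weight α] ψ) :
    fragIntegral a b φ =ᵐ[weight α] fragIntegral a b ψ := by
  filter_upwards [ae_weight_pos α] with x hx
  exact integral_congr_ae (fragIntegrand_congr h hx)

theorem InFragDomain.congr {φ ψ : ℝ → 𝕜} (h : φ =ᵐ[weight α] ψ) (hφ : InFragDomain a b α φ) :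
    InFragDomain a b α ψ := by
  refine ⟨?_, hφ.2.ae_eq (fragIntegral_congr h)⟩
  filter_upwards [hφ.1, ae_weight_pos α] with x hx hx0
  exact hx.congr (fragIntegrand_congr h hx0)

theorem fragIntegrand_add (φ ψ : ℝ → 𝕜) (x : ℝ) :
    fragIntegrand a b (φ + ψ) x = fragIntegrand a b φ x + fragIntegrand a b ψ x := by
  ext y
  simp [fragIntegrand, mul_add]

theorem fragIntegrand_smul (c : 𝕜) (φ : ℝ → 𝕜) (x : ℝ) :
    fragIntegrand a b (c • φ) x = c • fragIntegrand a b φ x := by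
  ext y
  simp [fragIntegrand, mul_left_comm]

theorem fragIntegral_add {φ ψ : ℝ → 𝕜} (hφ : InFragDomain a b α φ) (hψ : InFragDomain a b α ψ) :
    fragIntegral a b (φ + ψ) =ᵐ[weight α] fragIntegral a b φ + fragIntegral a b ψ := by
  filter_upwards [hφ.1, hψ.1] with x h1 h2
  simp only [fragIntegral, fragIntegrand_add, Pi.add_apply]
  exact integral_add h1 h2

theorem fragIntegral_smul (c : 𝕜) (φ : ℝ → 𝕜) :
    fragIntegral a b (c • φ) = c • fragIntegral a b φ := by
  ext x
  simp only [fragIntegral, fragIntegrand_smul, Pi.smul_apply]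
  exact integral_smul c _

theorem InFragDomain.add {φ ψ : ℝ → 𝕜} (hφ : InFragDomain a b α φ) (hψ : InFragDomain a b α ψ) :
    InFragDomain a b α (φ + ψ) := by
  refine ⟨?_, (hφ.2.add hψ.2).ae_eq (fragIntegral_add hφ hψ).symm⟩
  filter_upwards [hφ.1, hψ.1] with x h1 h2
  rw [fragIntegrand_add]
  exact h1.add h2

theorem InFragDomain.smul (c : 𝕜) {φ : ℝ → 𝕜} (hφ : InFragDomain a b α φ) :
    InFragDomain a b α (c • φ) := by
  refine ⟨?_, by rw [fragIntegral_smul]; exact hφ.2.const_smul c⟩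
  filter_upwards [hφ.1] with x h1
  rw [fragIntegrand_smul]
  exact h1.smul c

theorem InFragDomain.zero : InFragDomain a b α (0 : ℝ → 𝕜) := by
  have h : ∀ x, fragIntegrand a b (0 : ℝ → 𝕜) x = 0 := fun x => by
    ext y
    simp [fragIntegrand]
  have h' : fragIntegral a b (0 : ℝ → 𝕜) = 0 := by
    ext x
    simp [fragIntegral, h]
  refine ⟨ae_of_all _ fun x => ?_, ?_⟩
  · rw [h]
    exact integrable_zero _ _ _
  · rw [h']
    exact MemLp.zero

end Frag

/-- The fragmentation operator `(B φ)(x) = ∫_x^∞ a(y) b(x, y) φ(y) dy` on its maximal domain in the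
moment space. -/
def fragmentation (𝕜 : Type*) [RCLike 𝕜] (α : ℝ) (a : ℝ → ℝ) (b : ℝ → ℝ → ℝ) :
    X₀ 𝕜 α →ₗ.[𝕜] X₀ 𝕜 α where
  domain :=
    { carrier := {φ | InFragDomain a b α φ}
      add_mem' := fun {φ ψ} hφ hψ => (hφ.add hψ).congr (Lp.coeFn_add φ ψ).symm
      zero_mem' := InFragDomain.zero.congr (Lp.coeFn_zero 𝕜 1 (weight α)).symm
      smul_mem' := fun c φ hφ => (hφ.smul c).congr (Lp.coeFn_smul c φ).symm }
  toFun :=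
    { toFun := fun φ => φ.2.2.toLp (fragIntegral a b φ)
      map_add' := fun φ ψ => by
        rw [← MemLp.toLp_add]
        exact MemLp.toLp_congr _ _ ((fragIntegral_congr (Lp.coeFn_add φ.1 ψ.1)).trans
          (fragIntegral_add φ.2 ψ.2))
      map_smul' := fun c φ => by
        rw [RingHom.id_apply, ← MemLp.toLp_const_smul]
        refine MemLp.toLp_congr _ _ ((fragIntegral_congr (Lp.coeFn_smul c φ.1)).trans ?_)
        rw [fragIntegral_smul] }

/-- The ratio `n_{1,α}(y) / (1 + y)^α`, where `n_{1,α}(y) = ∫_0^y (1 + x)^α b(x, y) dx ∈ [0, ∞]`. -/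
def momentRatio (α : ℝ) (b : ℝ → ℝ → ℝ) (y : ℝ) : ℝ≥0∞ :=
  (∫⁻ x in Ioo 0 y, ENNReal.ofReal ((1 + x) ^ α * b x y)) / ENNReal.ofReal ((1 + y) ^ α)

/-- `limsup_{a(y) → ∞} n_{1,α}(y) / (1 + y)^α`, that is, the infimum over `c` of the suprema of the
ratio over `{y > 0 | a(y) ≥ c}`; it is `0` if `a` is bounded above. -/
def limsupRatio (α : ℝ) (a : ℝ → ℝ) (b : ℝ → ℝ → ℝ) : ℝ≥0∞ :=
  limsup (momentRatio α b) (comap a atTop ⊓ 𝓟 (Ioi 0))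

end GrowthFrag

end

/-!
Write `w(x) = (1 + x)^α`, and let `Y(x, t)` be the characteristic of `dx/dt = r(x)` starting at `x`.

**The transport semigroup.** The change of variables `y = Y(x, t)` gives
`∫ |U(t) f| w = ∫ |f(x)| exp (-∫_x^Y a/r) w(Y) dx`, and the linear bound `r(z) ≤ C (1 + z)` gives
`w(Y(x, t)) ≤ exp (α C t) w(x)` (`IsFlow.one_add_flow_le`). Hence `‖U(t)‖ ≤ exp (α C t)`; strong
continuity follows on continuous functions from pointwise convergence and Scheffé's lemma. The
resolvent of the generator `T` is the Laplace transform of the semigroup.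

**The key estimate** (`IsFlow.lintegral_absorption_le`) is, for `λ > α C` and `φ ∈ D(T)`,
`(λ - α C) ‖φ‖ + ‖a φ‖ ≤ ‖λ φ - T φ‖`.
It comes from applying the change of variables to the difference quotients of the orbit of `φ`: the
absorbed fraction in time `h` is `h a(x) + o(h)` for almost every `x`, by Lebesgue's differentiation
theorem, and Fatou's lemma passes to the limit.

**Fragmentation.** By Tonelli's theorem `‖B φ‖ ≤ ∫ a ρ |φ| w`, where `ρ` is the moment ratio. If
`ρ ≤ M` everywhere and `ρ ≤ θ` where `a ≥ c`, then `a ρ ≤ θ a + c M`, so that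
`‖B φ‖ ≤ θ ‖a φ‖ + c M ‖φ‖`. With the key estimate this gives relative boundedness and
`‖B (λ - T)⁻¹‖ ≤ max θ (c M / (λ - α C))`, where `θ` may be any number above the limit superior. The
norms `‖B (λ - T)⁻¹‖` decrease in `λ`, because these operators are positive and decrease in `λ`; so
they converge.

**Generation.** If `θ < 1`, then `λ - T - B` is invertible by a Neumann series for
`λ > ω := α C + c M`. The two estimates together give
`(λ - α C) ‖φ‖ + ‖a φ‖ ≤ ‖(λ - T - B) φ‖ + ‖a φ‖ + c M ‖φ‖`; so `‖(λ - T - B)⁻¹‖ ≤ 1 / (λ - ω)` in the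
original norm, and the Hille–Yosida theorem (`hilleYosida`) applies. Its Yosida approximations are
built from the positive resolvent, hence the semigroup is positive.

Positivity is handled through the relation `|f| ≤ Re g` (`IsDominated`), whose graph is a closed convex
cone also for complex scalars.
-/

set_option linter.unusedSectionVars false

noncomputable section

namespace GrowthFrag

/-! ### Construction of `C₀`-semigroups and their generators -/

section Semigroup

variable {𝕜 E : Type*} [RCLike 𝕜] [NormedAddCommGroup E] [NormedSpace 𝕜 E]

theorem C0Semigroup.HasGenerator.mem_domain {S : C0Semigroup 𝕜 E} {f g : E}
    (h : S.HasGenerator f g) : f ∈ S.generator.domain := ⟨g, h⟩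

theorem C0Semigroup.generator_hasGenerator (S : C0Semigroup 𝕜 E) (f : S.generator.domain) :
    S.HasGenerator f (S.generator f) := f.2.choose_spec

theorem C0Semigroup.HasGenerator.generator_eq {S : C0Semigroup 𝕜 E} {f g : E}
    (h : S.HasGenerator f g) (hf : f ∈ S.generator.domain) : S.generator ⟨f, hf⟩ = g :=
  (S.generator_hasGenerator ⟨f, hf⟩).unique h

/-- The generator commutes with every bounded operator which commutes with the semigroup. -/
theorem C0Semigroup.HasGenerator.map {S : C0Semigroup 𝕜 E} {f g : E}
    (h : S.HasGenerator f g) (L : E →L[𝕜] E) (hL : ∀ t f, L (S.op t f) = S.op t (L f)) :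
    S.HasGenerator (L f) (L g) := by
  refine ((L.continuous.tendsto g).comp h).congr fun t => ?_
  simp [C0Semigroup.quotient, hL]

theorem C0Semigroup.op_comm (S : C0Semigroup 𝕜 E) (s t : ℝ≥0) (f : E) :
    S.op s (S.op t f) = S.op t (S.op s f) := by
  have h := DFunLike.congr_fun (S.op_add s t) f
  rw [add_comm, S.op_add] at h
  exact h.symm

/-- Strong continuity of a semigroup of operators with `‖S(t)‖ ≤ exp (ω t)` has only to be checked
at `t = 0` and on a dense set of vectors. -/
def C0Semigroup.ofDense (op : ℝ≥0 → E →L[𝕜] E) (op_zero : op 0 = ContinuousLinearMap.id 𝕜 E)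
    (op_add : ∀ s t : ℝ≥0, op (s + t) = (op s).comp (op t)) (ω : ℝ) (hω : 0 ≤ ω)
    (bound : ∀ t : ℝ≥0, ‖op t‖ ≤ Real.exp (ω * t)) (D : Set E) (hD : Dense D)
    (hcont : ∀ f ∈ D, Tendsto (fun t => op t f) (𝓝 0) (𝓝 f)) : C0Semigroup 𝕜 E where
  op := op
  op_zero := op_zero
  op_add := op_add
  continuous_orbit := fun f => by
    have hb1 : ∀ t : ℝ≥0, t ≤ 1 → ‖op t‖ ≤ Real.exp ω := fun t ht =>
      (bound t).trans (Real.exp_le_exp.2 (mul_le_of_le_one_right hω (by exact_mod_cast ht)))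
    have h0 : Tendsto (fun t => op t f) (𝓝 0) (𝓝 f) := by
      rw [Metric.tendsto_nhds]
      intro ε hε
      set M := Real.exp ω with hM
      have hMpos : 0 < M := Real.exp_pos _
      obtain ⟨g, hgD, hg⟩ := hD.exists_dist_lt f (show 0 < ε / (2 * (M + 1)) by positivity)
      rw [dist_eq_norm] at hg
      have h1 := (Metric.tendsto_nhds.1 (hcont g hgD)) (ε / 2) (by positivity)
      filter_upwards [h1, Iic_mem_nhds (show (0 : ℝ≥0) < 1 by norm_num)] with t ht ht1
      rw [dist_eq_norm] at ht ⊢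
      have e : op t f - f = op t (f - g) + (op t g - g) - (f - g) := by
        rw [map_sub]; abel
      calc ‖op t f - f‖ ≤ ‖op t (f - g)‖ + ‖op t g - g‖ + ‖f - g‖ := by
            rw [e]; exact (norm_sub_le _ _).trans (by gcongr; exact norm_add_le _ _)
        _ ≤ M * ‖f - g‖ + ‖op t g - g‖ + ‖f - g‖ := by
            gcongr; exact (op t).le_of_opNorm_le (hb1 t ht1) _
        _ = (M + 1) * ‖f - g‖ + ‖op t g - g‖ := by ring
        _ < (M + 1) * (ε / (2 * (M + 1))) + ε / 2 := by gcongr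
        _ = ε := by field_simp; ring
    have key : ∀ s t : ℝ≥0, s ≤ t →
        ‖op t f - op s f‖ ≤ Real.exp (ω * s) * ‖op (t - s) f - f‖ := by
      intro s t hst
      have : op t f = op s (op (t - s) f) := by
        rw [← ContinuousLinearMap.comp_apply, ← op_add, add_tsub_cancel_of_le hst]
      rw [this, ← map_sub]
      exact (op s).le_of_opNorm_le (bound s) _
    rw [continuous_iff_continuousAt]
    intro t
    rw [ContinuousAt, tendsto_iff_norm_sub_tendsto_zero]
    have hd : Tendsto (fun s : ℝ≥0 => (s - t) + (t - s)) (𝓝 t) (𝓝 0) := by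
      have : Continuous fun s : ℝ≥0 => (s - t) + (t - s) := by fun_prop
      simpa using this.tendsto t
    have h2 : Tendsto (fun s : ℝ≥0 => Real.exp (ω * (t + 1)) * ‖op ((s - t) + (t - s)) f - f‖)
        (𝓝 t) (𝓝 0) := by
      have := ((h0.comp hd).sub_const f).norm.const_mul (Real.exp (ω * (t + 1)))
      simpa using this
    refine squeeze_zero' (Eventually.of_forall fun s => norm_nonneg _) ?_ h2
    filter_upwards [Iic_mem_nhds (show t < t + 1 by simp)] with s hs
    have hs' : (s : ℝ) ≤ t + 1 := by exact_mod_cast hs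
    rcases le_total s t with h | h
    · rw [norm_sub_rev, tsub_eq_zero_of_le h, zero_add]
      refine (key s t h).trans ?_
      gcongr
    · rw [tsub_eq_zero_of_le h, add_zero]
      refine (key t s h).trans ?_
      gcongr
      linarith

/-- Two bounded inverses of `z - T` coincide. -/
theorem IsResolventAt.unique {T : E →ₗ.[𝕜] E} {z : 𝕜} {R R' : E →L[𝕜] E}
    (h : IsResolventAt T z R) (h' : IsResolventAt T z R') : R = R' := by
  ext f
  obtain ⟨hf, e⟩ := h.1 f
  have := h'.2 ⟨R f, hf⟩
  rw [e] at this
  exact this.symm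

theorem IsResolventAt.mem_domain {T : E →ₗ.[𝕜] E} {z : 𝕜} {R : E →L[𝕜] E}
    (h : IsResolventAt T z R) (f : E) : R f ∈ T.domain := (h.1 f).choose

theorem IsResolventAt.eq_sub {T : E →ₗ.[𝕜] E} {z : 𝕜} {R : E →L[𝕜] E}
    (h : IsResolventAt T z R) (f : E) (hf : R f ∈ T.domain) : T ⟨R f, hf⟩ = z • R f - f := by
  obtain ⟨h1, e⟩ := h.1 f
  exact eq_sub_of_add_eq (add_comm (T ⟨R f, hf⟩) f ▸ (sub_eq_iff_eq_add.1 e).symm)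

/-- The first resolvent identity. -/
theorem IsResolventAt.sub_eq {T : E →ₗ.[𝕜] E} {z w : 𝕜} {R Q : E →L[𝕜] E}
    (hR : IsResolventAt T z R) (hQ : IsResolventAt T w Q) (f : E) :
    R f + (z - w) • R (Q f) = Q f := by
  have h := hR.2 ⟨Q f, hQ.mem_domain f⟩
  rw [hQ.eq_sub f] at h
  have e : z • Q f - (w • Q f - f) = f + (z - w) • Q f := by rw [sub_smul]; abel
  simpa only [e, map_add, map_smul] using h

theorem IsResolventAt.comm {T : E →ₗ.[𝕜] E} {z w : 𝕜} {R Q : E →L[𝕜] E}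
    (hR : IsResolventAt T z R) (hQ : IsResolventAt T w Q) : Commute R Q := by
  rcases eq_or_ne z w with rfl | hne
  · rw [hR.unique hQ]
  · ext f
    have h1 := hR.sub_eq hQ f
    have h2 := hQ.sub_eq hR f
    have h3 : (z - w) • (R (Q f) - Q (R f)) = 0 := by
      have e : (w - z) • Q (R f) = -((z - w) • Q (R f)) := by rw [← neg_smul, neg_sub]
      rw [e] at h2
      rw [smul_sub, sub_eq_zero, eq_sub_of_add_eq' h1, sub_eq_iff_eq_add, add_comm]
      exact add_neg_eq_iff_eq_add.1 h2
    exact sub_eq_zero.1 ((smul_eq_zero.1 h3).resolve_left (sub_ne_zero.2 hne))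

/-- An operator with a resolvent at `z` has no proper extension with a resolvent at `z`. -/
theorem IsResolventAt.eq_of_le {T T' : E →ₗ.[𝕜] E} {z : 𝕜} {R R' : E →L[𝕜] E}
    (h : IsResolventAt T z R) (h' : IsResolventAt T' z R') (hle : T ≤ T') : T = T' := by
  refine LinearPMap.eq_of_le_of_domain_eq hle (le_antisymm hle.1 fun φ hφ => ?_)
  have hRR : R = R' := by
    ext f
    have e := h'.2 ⟨R f, hle.1 (h.mem_domain f)⟩
    have e2 : T' ⟨R f, hle.1 (h.mem_domain f)⟩ = z • R f - f := by
      rw [← h.eq_sub f (h.mem_domain f)]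
      exact (hle.2 rfl).symm
    rw [e2] at e
    simpa using e.symm
  have := h'.2 ⟨φ, hφ⟩
  rw [← hRR] at this
  simp only at this
  rw [← this]
  exact h.mem_domain _

variable [NormedSpace ℝ E] [IsScalarTower ℝ 𝕜 E]

/-- An orbit that is, for `t ≥ 0`, the restriction of a function with derivative `g` at `0` has
generator value `g`. -/
theorem C0Semigroup.HasGenerator.of_hasDerivAt {S : C0Semigroup 𝕜 E} {f g : E} {u : ℝ → E}
    (hu : HasDerivAt u g 0) (h : ∀ t : ℝ≥0, S.op t f = u t) : S.HasGenerator f g := by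
  have hf : u 0 = f := by
    have := h 0
    rw [S.op_zero] at this
    simpa using this.symm
  have h1 : Tendsto (fun t : ℝ≥0 => (t : ℝ)) (𝓝[>] (0 : ℝ≥0)) (𝓝[≠] (0 : ℝ)) := by
    refine tendsto_nhdsWithin_iff.2 ⟨?_, ?_⟩
    · exact (NNReal.continuous_coe.tendsto' 0 0 (by simp)).mono_left nhdsWithin_le_nhds
    · filter_upwards [self_mem_nhdsWithin] with t ht
      have : (0 : ℝ) < t := by exact_mod_cast (ht : (0 : ℝ≥0) < t)
      exact this.ne'
  refine ((hasDerivAt_iff_tendsto_slope.1 hu).comp h1).congr fun t => ?_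
  simp [slope, C0Semigroup.quotient, h, hf, RCLike.real_smul_eq_coe_smul (K := 𝕜)]

variable [CompleteSpace E]

/-! ### The resolvent as Laplace transform of the semigroup -/

/-- The integrand of the Laplace transform, on the real line. -/
def C0Semigroup.damped (S : C0Semigroup 𝕜 E) (lam : ℝ) (f : E) (t : ℝ) : E :=
  Real.exp (-lam * t) • S.op t.toNNReal f

theorem C0Semigroup.continuous_damped (S : C0Semigroup 𝕜 E) (lam : ℝ) (f : E) :
    Continuous (S.damped lam f) := by
  have := (S.continuous_orbit f).comp continuous_real_toNNReal
  unfold C0Semigroup.damped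
  exact Continuous.smul (by fun_prop) this

theorem C0Semigroup.norm_damped_le {S : C0Semigroup 𝕜 E} {ω : ℝ}
    (hS : ∀ t : ℝ≥0, ‖S.op t‖ ≤ Real.exp (ω * t)) (lam : ℝ) (f : E) {t : ℝ} (ht : 0 ≤ t) :
    ‖S.damped lam f t‖ ≤ Real.exp (-(lam - ω) * t) * ‖f‖ := by
  rw [C0Semigroup.damped, norm_smul, Real.norm_of_nonneg (Real.exp_pos _).le]
  calc _ ≤ Real.exp (-lam * t) * (Real.exp (ω * t) * ‖f‖) := by
        gcongr
        have := (S.op t.toNNReal).le_of_opNorm_le (hS _) f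
        rwa [Real.coe_toNNReal t ht] at this
    _ = _ := by rw [← mul_assoc, ← Real.exp_add]; ring_nf

theorem C0Semigroup.integrableOn_damped {S : C0Semigroup 𝕜 E} {ω lam : ℝ}
    (hS : ∀ t : ℝ≥0, ‖S.op t‖ ≤ Real.exp (ω * t)) (hlam : ω < lam) (f : E) :
    IntegrableOn (S.damped lam f) (Ioi 0) := by
  refine Integrable.mono' ((exp_neg_integrableOn_Ioi 0 (sub_pos.2 hlam)).mul_const ‖f‖)
    (S.continuous_damped lam f).aestronglyMeasurable ?_
  filter_upwards [ae_restrict_mem measurableSet_Ioi] with t ht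
  exact norm_damped_le hS lam f (le_of_lt ht)

/-- The Laplace transform `∫_0^∞ exp (-λ t) S(t) f dt`. -/
def C0Semigroup.laplace (S : C0Semigroup 𝕜 E) (lam : ℝ) (f : E) : E :=
  ∫ t in Ioi (0 : ℝ), S.damped lam f t

theorem C0Semigroup.norm_laplace_le {S : C0Semigroup 𝕜 E} {ω lam : ℝ}
    (hS : ∀ t : ℝ≥0, ‖S.op t‖ ≤ Real.exp (ω * t)) (hlam : ω < lam) (f : E) :
    ‖S.laplace lam f‖ ≤ (∫ t in Ioi (0 : ℝ), Real.exp (-(lam - ω) * t)) * ‖f‖ := by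
  rw [C0Semigroup.laplace, ← integral_mul_const]
  refine norm_integral_le_of_norm_le
    ((exp_neg_integrableOn_Ioi 0 (sub_pos.2 hlam)).mul_const ‖f‖) ?_
  filter_upwards [ae_restrict_mem measurableSet_Ioi] with t ht
  exact norm_damped_le hS lam f (le_of_lt ht)

/-- The semigroup shifts the Laplace transform: its value at `h` on the transform removes the
integral over `(0, h]`. -/
theorem C0Semigroup.op_laplace {S : C0Semigroup 𝕜 E} {ω lam : ℝ}
    (hS : ∀ t : ℝ≥0, ‖S.op t‖ ≤ Real.exp (ω * t)) (hlam : ω < lam) (f : E) (h : ℝ≥0) :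
    S.op h (S.laplace lam f) =
      Real.exp (lam * h) • (S.laplace lam f - ∫ t in (0 : ℝ)..h, S.damped lam f t) := by
  have hi := integrableOn_damped hS hlam f
  have e1 : S.op h (S.laplace lam f) =
      ∫ t in Ioi (0 : ℝ), Real.exp (lam * h) • S.damped lam f (t + h) := by
    rw [C0Semigroup.laplace, ← ContinuousLinearMap.integral_comp_comm _ hi]
    refine setIntegral_congr_fun measurableSet_Ioi fun t ht => ?_
    have ht' : (0 : ℝ) ≤ t := le_of_lt ht
    have : (t + (h : ℝ)).toNNReal = h + t.toNNReal := by
      rw [Real.toNNReal_add ht' h.coe_nonneg, Real.toNNReal_coe, add_comm]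
    simp only [C0Semigroup.damped, this, S.op_add, ContinuousLinearMap.comp_apply]
    rw [RCLike.real_smul_eq_coe_smul (K := 𝕜), map_smul, smul_smul, ← Real.exp_add,
      ← RCLike.real_smul_eq_coe_smul (K := 𝕜)]
    congr 2
    ring
  have e2 : ∫ t in Ioi (0 : ℝ), S.damped lam f (t + h) = ∫ t in Ioi (h : ℝ), S.damped lam f t := by
    have hm : MeasurePreserving (fun t : ℝ => t + h) volume volume :=
      measurePreserving_add_right volume (h : ℝ)
    have := hm.setIntegral_preimage_emb (Homeomorph.addRight (h : ℝ)).measurableEmbedding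
      (S.damped lam f) (Ioi (h : ℝ))
    rw [← this]
    congr 2
    ext t
    simp
  have e3 : S.laplace lam f - ∫ t in (0 : ℝ)..h, S.damped lam f t =
      ∫ t in Ioi (h : ℝ), S.damped lam f t := by
    rw [C0Semigroup.laplace, sub_eq_iff_eq_add, intervalIntegral.integral_of_le h.coe_nonneg, add_comm,
      ← setIntegral_union (Ioc_disjoint_Ioi le_rfl) measurableSet_Ioi
        (hi.mono_set Ioc_subset_Ioi_self) (hi.mono_set (Ioi_subset_Ioi h.coe_nonneg)),
      Ioc_union_Ioi_eq_Ioi h.coe_nonneg]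
  rw [e1, integral_smul, e2, e3]

theorem C0Semigroup.laplace_hasGenerator {S : C0Semigroup 𝕜 E} {ω lam : ℝ}
    (hS : ∀ t : ℝ≥0, ‖S.op t‖ ≤ Real.exp (ω * t)) (hlam : ω < lam) (f : E) :
    S.HasGenerator (S.laplace lam f) ((lam : 𝕜) • S.laplace lam f - f) := by
  have hd : HasDerivAt (fun h : ℝ => ∫ t in (0 : ℝ)..h, S.damped lam f t) f 0 := by
    have := ((S.continuous_damped lam f).integral_hasStrictDerivAt 0 0).hasDerivAt
    simpa [C0Semigroup.damped, S.op_zero] using this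
  have he : HasDerivAt (fun h : ℝ => Real.exp (lam * h)) lam 0 := by
    simpa using ((hasDerivAt_id (0 : ℝ)).const_mul lam).exp
  have := he.smul (hd.const_sub (S.laplace lam f))
  refine C0Semigroup.HasGenerator.of_hasDerivAt
    (u := fun h => Real.exp (lam * h) • (S.laplace lam f - ∫ t in (0 : ℝ)..h, S.damped lam f t))
    ?_ (op_laplace hS hlam f)
  refine this.congr_deriv ?_
  rw [← RCLike.real_smul_eq_coe_smul (K := 𝕜)]
  simp
  abel

theorem C0Semigroup.exists_resolvent {S : C0Semigroup 𝕜 E} {ω lam : ℝ}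
    (hS : ∀ t : ℝ≥0, ‖S.op t‖ ≤ Real.exp (ω * t)) (hlam : ω < lam) :
    ∃ R : E →L[𝕜] E, (∀ f, R f = S.laplace lam f) ∧ IsResolventAt S.generator (lam : 𝕜) R := by
  have hadd : ∀ f g, S.laplace lam (f + g) = S.laplace lam f + S.laplace lam g := fun f g => by
    rw [C0Semigroup.laplace, C0Semigroup.laplace, C0Semigroup.laplace,
      ← integral_add (integrableOn_damped hS hlam f) (integrableOn_damped hS hlam g)]
    simp [C0Semigroup.damped]
  have hsmul : ∀ (c : 𝕜) f, S.laplace lam (c • f) = c • S.laplace lam f := fun c f => by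
    rw [C0Semigroup.laplace, C0Semigroup.laplace, ← integral_smul]
    simp only [C0Semigroup.damped, map_smul]
    congr 1
    ext t
    rw [smul_comm]
  let R : E →L[𝕜] E := LinearMap.mkContinuous
    { toFun := S.laplace lam, map_add' := hadd, map_smul' := hsmul } _ (norm_laplace_le hS hlam)
  have hR : ∀ f, R f = S.laplace lam f := fun f => rfl
  refine ⟨R, hR, fun f => ?_, fun φ => ?_⟩
  · have h := laplace_hasGenerator hS hlam f
    refine ⟨h.mem_domain, ?_⟩
    simp only [hR]
    rw [h.generator_eq]
    abel
  · have hcomm : ∀ t f, R (S.op t f) = S.op t (R f) := fun t f => by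
      rw [hR, hR, C0Semigroup.laplace, C0Semigroup.laplace,
        ← ContinuousLinearMap.integral_comp_comm _ (integrableOn_damped hS hlam f)]
      congr 1
      ext s
      simp only [C0Semigroup.damped]
      rw [RCLike.real_smul_eq_coe_smul (K := 𝕜), RCLike.real_smul_eq_coe_smul (K := 𝕜), map_smul,
        S.op_comm]
    have h1 := (S.generator_hasGenerator φ).map R hcomm
    have h2 := h1.unique (laplace_hasGenerator hS hlam (φ : E))
    rw [map_sub, map_smul, h2, hR]
    abel

/-- The generator of a semigroup is densely defined: `f` is the limit as `h → 0` of the means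
`(1/h) ∫_0^h exp (-λ t) S(t) f dt`, and these differ from elements `S(h) g` with `g` in the domain by
elements of the domain. -/
theorem C0Semigroup.dense_domain {S : C0Semigroup 𝕜 E} {ω : ℝ}
    (hS : ∀ t : ℝ≥0, ‖S.op t‖ ≤ Real.exp (ω * t)) :
    Dense (S.generator.domain : Set E) := by
  intro f
  set lam := ω + 1
  have hlam : ω < lam := by simp [lam]
  have hd : HasDerivAt (fun h : ℝ => ∫ t in (0 : ℝ)..h, S.damped lam f t) f 0 := by
    have := ((S.continuous_damped lam f).integral_hasStrictDerivAt 0 0).hasDerivAt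
    simpa [C0Semigroup.damped, S.op_zero] using this
  have ht := (hasDerivAt_iff_tendsto_slope.1 hd).mono_left
    (nhdsWithin_mono 0 (show Ioi (0 : ℝ) ⊆ {0}ᶜ from fun x hx => (ne_of_gt hx)))
  refine mem_closure_of_tendsto ht ?_
  filter_upwards [self_mem_nhdsWithin] with h hh
  have hh' : (0 : ℝ) ≤ h := le_of_lt hh
  obtain ⟨g, hg⟩ := (laplace_hasGenerator hS hlam f).mem_domain
  have h1 : S.laplace lam f ∈ S.generator.domain := ⟨g, hg⟩
  have h2 : S.op h.toNNReal (S.laplace lam f) ∈ S.generator.domain :=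
    ⟨_, hg.map (S.op h.toNNReal) fun t f => S.op_comm _ _ _⟩
  have e := op_laplace hS hlam f h.toNNReal
  rw [Real.coe_toNNReal h hh'] at e
  have e' : ∫ t in (0 : ℝ)..h, S.damped lam f t =
      S.laplace lam f - ((Real.exp (-(lam * h)) : ℝ) : 𝕜) • S.op h.toNNReal (S.laplace lam f) := by
    rw [e, ← RCLike.real_smul_eq_coe_smul (K := 𝕜), smul_smul, ← Real.exp_add]
    simp
  have : slope (fun h : ℝ => ∫ t in (0 : ℝ)..h, S.damped lam f t) 0 h =
      ((h⁻¹ : ℝ) : 𝕜) • (S.laplace lam f -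
        ((Real.exp (-(lam * h)) : ℝ) : 𝕜) • S.op h.toNNReal (S.laplace lam f)) := by
    rw [← e', ← RCLike.real_smul_eq_coe_smul (K := 𝕜)]
    simp [slope]
  rw [this]
  exact S.generator.domain.smul_mem _
    (S.generator.domain.sub_mem h1 (S.generator.domain.smul_mem _ h2))

end Semigroup

/-! ### Exponentials of bounded operators -/

section BoundedGenerator

variable {𝕜 E : Type*} [RCLike 𝕜] [NormedAddCommGroup E] [NormedSpace 𝕜 E]

theorem norm_pow_apply_le (Q : E →L[𝕜] E) (n : ℕ) (f : E) : ‖(Q ^ n) f‖ ≤ ‖Q‖ ^ n * ‖f‖ := by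
  induction n with
  | zero => simp
  | succ n ih =>
    rw [pow_succ', mul_apply_eq_comp, pow_succ', mul_assoc]
    exact (Q.le_opNorm _).trans (by gcongr)

variable [CompleteSpace E]

/-- The group `exp (t (Q - c))` generated by the bounded operator `Q - c`. The scalar factor is split
off since it is `exp (t Q)` that inherits positivity from `Q`. -/
def expOp (Q : E →L[𝕜] E) (c t : ℝ) : E →L[𝕜] E :=
  ((Real.exp (-c * t) : ℝ) : 𝕜) • NormedSpace.exp ((t : 𝕜) • Q)

theorem hasSum_exp_apply (Q : E →L[𝕜] E) (t : ℝ) (f : E) :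
    HasSum (fun n : ℕ => ((n.factorial : 𝕜)⁻¹ * (t : 𝕜) ^ n) • (Q ^ n) f)
      (NormedSpace.exp ((t : 𝕜) • Q) f) := by
  have h := NormedSpace.exp_series_hasSum_exp' (𝕂 := 𝕜) ((t : 𝕜) • Q)
  have h2 := h.mapL (ContinuousLinearMap.apply 𝕜 E f)
  simpa [smul_pow, smul_smul] using h2

theorem norm_exp_apply_le (Q : E →L[𝕜] E) {t : ℝ} (ht : 0 ≤ t) (f : E) :
    ‖NormedSpace.exp ((t : 𝕜) • Q) f‖ ≤ Real.exp (t * ‖Q‖) * ‖f‖ := by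
  have h : HasSum (fun n : ℕ => (t * ‖Q‖) ^ n / n.factorial) (Real.exp (t * ‖Q‖)) := by
    rw [Real.exp_eq_exp_ℝ]
    exact NormedSpace.expSeries_div_hasSum_exp _
  refine (hasSum_exp_apply Q t f).norm_le_of_bounded (h.mul_right ‖f‖) fun n => ?_
  rw [norm_smul, norm_mul, norm_inv, norm_pow, RCLike.norm_natCast, RCLike.norm_ofReal,
    abs_of_nonneg ht]
  calc _ ≤ (n.factorial : ℝ)⁻¹ * t ^ n * (‖Q‖ ^ n * ‖f‖) := by
        gcongr; exact norm_pow_apply_le Q n f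
    _ = _ := by rw [mul_pow]; ring

theorem norm_expOp_le (Q : E →L[𝕜] E) (c : ℝ) {t : ℝ} (ht : 0 ≤ t) :
    ‖expOp Q c t‖ ≤ Real.exp ((‖Q‖ - c) * t) := by
  refine ContinuousLinearMap.opNorm_le_bound _ (Real.exp_pos _).le fun f => ?_
  rw [expOp, smul_apply, norm_smul, RCLike.norm_ofReal, abs_of_pos (Real.exp_pos _)]
  calc _ ≤ Real.exp (-c * t) * (Real.exp (t * ‖Q‖) * ‖f‖) := by
        gcongr; exact norm_exp_apply_le Q ht f
    _ = _ := by rw [← mul_assoc, ← Real.exp_add]; ring_nf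

theorem expOp_zero (Q : E →L[𝕜] E) (c : ℝ) : expOp Q c 0 = 1 := by
  simp [expOp]

theorem expOp_add (Q : E →L[𝕜] E) (c s t : ℝ) : expOp Q c (s + t) = expOp Q c s * expOp Q c t := by
  let : NormedAlgebra ℚ 𝕜 := NormedAlgebra.restrictScalars ℚ ℝ 𝕜
  let : NormedAlgebra ℚ (E →L[𝕜] E) := NormedAlgebra.restrictScalars ℚ 𝕜 (E →L[𝕜] E)
  have h : Commute ((s : 𝕜) • Q) ((t : 𝕜) • Q) :=
    ((Commute.refl Q).smul_left _).smul_right _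
  rw [expOp, expOp, expOp, smul_mul_smul_comm, ← NormedSpace.exp_add_of_commute h, ← add_smul,
    mul_add, Real.exp_add]
  push_cast
  rfl

variable [NormedSpace ℝ E] [IsScalarTower ℝ 𝕜 E]

theorem hasDerivAt_expOp (Q : E →L[𝕜] E) (c t : ℝ) :
    HasDerivAt (fun u => (expOp Q c u : E →L[𝕜] E)) (expOp Q c t * (Q - (c : 𝕜) • 1)) t := by
  have h1 : HasDerivAt (fun u : ℝ => NormedSpace.exp ((u : 𝕜) • Q))
      (NormedSpace.exp ((t : 𝕜) • Q) * Q) t := by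
    have := (hasDerivAt_exp_smul_const (𝕂 := 𝕜) Q (t : 𝕜)).scomp t
      (RCLike.ofRealCLM (K := 𝕜)).hasDerivAt
    simpa [Function.comp_def] using this
  have h2 : HasDerivAt (fun u : ℝ => Real.exp (-c * u)) (Real.exp (-c * t) * -c) t := by
    simpa using ((hasDerivAt_id t).const_mul (-c)).exp
  have h3 := h2.smul h1
  refine (h3.congr_deriv ?_).congr_of_eventuallyEq (Eventually.of_forall fun u => ?_)
  · ext f
    simp only [expOp, add_apply, smul_apply, mul_apply_eq_comp, sub_apply, map_sub,
      map_smul, one_apply_eq_self, RCLike.real_smul_eq_coe_smul (K := 𝕜),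
      smul_smul]
    push_cast
    rw [mul_neg, neg_smul, mul_comm (c : 𝕜)]
    abel
  · simp only [expOp, Pi.smul_apply']
    rw [RCLike.real_smul_eq_coe_smul (K := 𝕜)]

theorem hasDerivAt_expOp_apply (Q : E →L[𝕜] E) (c t : ℝ) (f : E) :
    HasDerivAt (fun u => expOp Q c u f) (expOp Q c t (Q f - (c : 𝕜) • f)) t := by
  have h := ((ContinuousLinearMap.apply 𝕜 E f).restrictScalars ℝ).hasFDerivAt.comp_hasDerivAt t
    (hasDerivAt_expOp Q c t)
  simpa [Function.comp_def] using h

/-- Two commuting semigroups `exp (t (Q - c))` and `exp (t (Q' - c'))` of the same growth are close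
on `f` when their generators are close on `f`. -/
theorem norm_expOp_sub_le {Q Q' : E →L[𝕜] E} (h : Commute Q Q') {c c' ω : ℝ}
    (hQ : ‖Q‖ - c ≤ ω) (hQ' : ‖Q'‖ - c' ≤ ω) {t : ℝ} (ht : 0 ≤ t) (f : E) :
    ‖expOp Q c t f - expOp Q' c' t f‖ ≤
      Real.exp (ω * t) * t * ‖(Q f - (c : 𝕜) • f) - (Q' f - (c' : 𝕜) • f)‖ := by
  have hd : ∀ u, HasDerivAt (fun u => (expOp Q c u * expOp Q' c' (t - u)) f)
      ((expOp Q c u * expOp Q' c' (t - u)) ((Q f - (c : 𝕜) • f) - (Q' f - (c' : 𝕜) • f))) u := by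
    intro u
    have h1 := (hasDerivAt_expOp Q c u)
    have h2 := (hasDerivAt_expOp Q' c' (t - u)).scomp u ((hasDerivAt_id u).const_sub t)
    have hm := (((ContinuousLinearMap.compL 𝕜 E E E).bilinearRestrictScalars ℝ).hasFDerivAt_of_bilinear
      h1.hasFDerivAt h2.hasFDerivAt).hasDerivAt
    have h' := ((ContinuousLinearMap.apply 𝕜 E f).restrictScalars ℝ).hasFDerivAt.comp_hasDerivAt u hm
    refine h'.congr_deriv ?_
    have hc : ∀ g, expOp Q c u (Q (expOp Q' c' (t - u) g)) =
        expOp Q c u (expOp Q' c' (t - u) (Q g)) := fun g => by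
      have : Commute Q (expOp Q' c' (t - u)) := by
        have := (h.smul_right ((t - u : ℝ) : 𝕜)).exp_right
        exact this.smul_right _
      rw [← mul_apply_eq_comp Q, this.eq]
      rfl
    simp [hc, map_sub]
    abel
  have hb : ∀ u ∈ Ico 0 t, ‖(expOp Q c u * expOp Q' c' (t - u))
      ((Q f - (c : 𝕜) • f) - (Q' f - (c' : 𝕜) • f))‖ ≤
      Real.exp (ω * t) * ‖(Q f - (c : 𝕜) • f) - (Q' f - (c' : 𝕜) • f)‖ := by
    intro u hu
    refine ContinuousLinearMap.le_of_opNorm_le _ ?_ _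
    calc ‖expOp Q c u * expOp Q' c' (t - u)‖ ≤ ‖expOp Q c u‖ * ‖expOp Q' c' (t - u)‖ :=
          norm_mul_le _ _
      _ ≤ Real.exp (ω * u) * Real.exp (ω * (t - u)) := by
          gcongr
          · refine (norm_expOp_le Q c hu.1).trans (Real.exp_le_exp.2 ?_)
            exact mul_le_mul_of_nonneg_right hQ hu.1
          · have : 0 ≤ t - u := sub_nonneg.2 hu.2.le
            refine (norm_expOp_le Q' c' this).trans (Real.exp_le_exp.2 ?_)
            exact mul_le_mul_of_nonneg_right hQ' this
      _ = _ := by rw [← Real.exp_add]; ring_nf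
  have := norm_image_sub_le_of_norm_deriv_le_segment' (fun u _ => (hd u).hasDerivWithinAt) hb t
    (right_mem_Icc.2 ht)
  simp only [sub_self, sub_zero, expOp_zero, mul_one, one_mul] at this
  linarith

end BoundedGenerator

/-! ### The Hille–Yosida theorem -/

section HilleYosida

variable {𝕜 E : Type*} [RCLike 𝕜] [NormedAddCommGroup E] [NormedSpace 𝕜 E]

theorem tendsto_apply_of_dense {L : ℕ → E →L[𝕜] E} {L' : E →L[𝕜] E} {M : ℝ}
    (hL : ∀ n, ‖L n‖ ≤ M) {D : Set E} (hD : Dense D)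
    (h : ∀ f ∈ D, Tendsto (fun n => L n f) atTop (𝓝 (L' f))) (f : E) :
    Tendsto (fun n => L n f) atTop (𝓝 (L' f)) := by
  rw [Metric.tendsto_atTop]
  intro ε hε
  have hM : 0 ≤ M := (norm_nonneg _).trans (hL 0)
  set K := M + ‖L'‖ + 1 with hK
  have hKpos : 0 < K := by positivity
  obtain ⟨g, hgD, hg⟩ := hD.exists_dist_lt f (show 0 < ε / (2 * K) by positivity)
  rw [dist_eq_norm] at hg
  obtain ⟨N, hN⟩ := Metric.tendsto_atTop.1 (h g hgD) (ε / 2) (by positivity)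
  refine ⟨N, fun n hn => ?_⟩
  have h1 := hN n hn
  rw [dist_eq_norm] at h1 ⊢
  have e : L n f - L' f = L n (f - g) + (L n g - L' g) - L' (f - g) := by
    rw [map_sub, map_sub]; abel
  calc ‖L n f - L' f‖ ≤ ‖L n (f - g)‖ + ‖L n g - L' g‖ + ‖L' (f - g)‖ := by
        rw [e]; exact (norm_sub_le _ _).trans (by gcongr; exact norm_add_le _ _)
    _ ≤ M * ‖f - g‖ + ‖L n g - L' g‖ + ‖L'‖ * ‖f - g‖ := by
        gcongr
        · exact (L n).le_of_opNorm_le (hL n) _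
        · exact L'.le_opNorm _
    _ ≤ K * ‖f - g‖ + ‖L n g - L' g‖ := by rw [hK]; nlinarith [norm_nonneg (f - g)]
    _ < K * (ε / (2 * K)) + ε / 2 := by gcongr
    _ = ε := by field_simp; ring

theorem cauchySeq_apply_of_dense {L : ℕ → E →L[𝕜] E} {M : ℝ}
    (hL : ∀ n, ‖L n‖ ≤ M) {D : Set E} (hD : Dense D)
    (h : ∀ f ∈ D, CauchySeq (fun n => L n f)) (f : E) : CauchySeq (fun n => L n f) := by
  rw [Metric.cauchySeq_iff]
  intro ε hε
  have hM : 0 ≤ M := (norm_nonneg _).trans (hL 0)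
  set K := 2 * M + 1 with hK
  have hKpos : 0 < K := by positivity
  obtain ⟨g, hgD, hg⟩ := hD.exists_dist_lt f (show 0 < ε / (2 * K) by positivity)
  rw [dist_eq_norm] at hg
  obtain ⟨N, hN⟩ := Metric.cauchySeq_iff.1 (h g hgD) (ε / 2) (by positivity)
  refine ⟨N, fun m hm n hn => ?_⟩
  have h1 := hN m hm n hn
  rw [dist_eq_norm] at h1 ⊢
  have e : L m f - L n f = L m (f - g) + (L m g - L n g) - L n (f - g) := by
    rw [map_sub, map_sub]; abel
  calc ‖L m f - L n f‖ ≤ ‖L m (f - g)‖ + ‖L m g - L n g‖ + ‖L n (f - g)‖ := by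
        rw [e]; exact (norm_sub_le _ _).trans (by gcongr; exact norm_add_le _ _)
    _ ≤ M * ‖f - g‖ + ‖L m g - L n g‖ + M * ‖f - g‖ := by
        gcongr
        · exact (L m).le_of_opNorm_le (hL m) _
        · exact (L n).le_of_opNorm_le (hL n) _
    _ ≤ K * ‖f - g‖ + ‖L m g - L n g‖ := by rw [hK]; nlinarith [norm_nonneg (f - g)]
    _ < K * (ε / (2 * K)) + ε / 2 := by gcongr
    _ = ε := by field_simp; ring

/-- The bounded part `κ² R(ω + κ)` of the Yosida approximation `κ² R(ω + κ) - (κ - ω)` of an operator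
with resolvent `R`. -/
def yosidaPart (R : ℝ → E →L[𝕜] E) (ω κ : ℝ) : E →L[𝕜] E := ((κ ^ 2 : ℝ) : 𝕜) • R (ω + κ)

/-- The semigroups generated by the Yosida approximations with parameter `κ = n + 1`. -/
def yosidaOp [CompleteSpace E] (R : ℝ → E →L[𝕜] E) (ω : ℝ) (n : ℕ) (t : ℝ) : E →L[𝕜] E :=
  expOp (yosidaPart R ω (n + 1)) (n + 1 - ω) t

/-- The Yosida approximations with parameter `κ = n + 1`. -/
def yosidaApprox (R : ℝ → E →L[𝕜] E) (ω : ℝ) (n : ℕ) (f : E) : E :=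
  yosidaPart R ω (n + 1) f - ((n + 1 - ω : ℝ) : 𝕜) • f

theorem norm_yosidaPart_le {R : ℝ → E →L[𝕜] E} {ω : ℝ}
    (hb : ∀ lam, ω < lam → ‖R lam‖ ≤ (lam - ω)⁻¹) (n : ℕ) :
    ‖yosidaPart R ω (n + 1)‖ - (n + 1 - ω) ≤ ω := by
  have hκ : (0 : ℝ) < n + 1 := by positivity
  have h := hb (ω + (n + 1)) (by linarith)
  rw [add_sub_cancel_left] at h
  have : ‖yosidaPart R ω (n + 1)‖ ≤ n + 1 := by
    rw [yosidaPart, norm_smul, RCLike.norm_ofReal, abs_of_nonneg (by positivity)]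
    calc _ ≤ ((n : ℝ) + 1) ^ 2 * ((n : ℝ) + 1)⁻¹ := by gcongr
      _ = n + 1 := by field_simp
  linarith

/-- On the domain of `A`, the Yosida approximations converge to `A`. -/
theorem tendsto_yosidaApprox {A : E →ₗ.[𝕜] E} {ω : ℝ} (hdense : Dense (A.domain : Set E))
    {R : ℝ → E →L[𝕜] E} (hR : ∀ lam : ℝ, ω < lam → IsResolventAt A (lam : 𝕜) (R lam))
    (hb : ∀ lam, ω < lam → ‖R lam‖ ≤ (lam - ω)⁻¹) (φ : A.domain) :
    Tendsto (fun n => yosidaApprox R ω n φ) atTop (𝓝 (A φ)) := by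
  set P : ℕ → E →L[𝕜] E := fun n => ((n + 1 : ℝ) : 𝕜) • R (ω + (n + 1)) with hP
  have hpos : ∀ n : ℕ, (0 : ℝ) < n + 1 := fun n => by positivity
  have hbn : ∀ n : ℕ, ‖R (ω + (n + 1))‖ ≤ ((n : ℝ) + 1)⁻¹ := fun n => by
    simpa using hb (ω + (n + 1)) (by linarith [hpos n])
  have hPb : ∀ n, ‖P n‖ ≤ 1 := fun n => by
    rw [hP, norm_smul, RCLike.norm_ofReal, abs_of_pos (hpos n)]
    calc _ ≤ ((n : ℝ) + 1) * ((n : ℝ) + 1)⁻¹ := by gcongr; exact hbn n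
      _ = 1 := mul_inv_cancel₀ (hpos n).ne'
  -- the resolvent equation on the domain
  have hid : ∀ (n : ℕ) (ψ : A.domain), P n ψ = ψ + R (ω + (n + 1)) (A ψ - (ω : 𝕜) • (ψ : E)) := by
    intro n ψ
    have h := (hR (ω + (n + 1)) (by linarith [hpos n])).2 ψ
    rw [map_sub, map_smul] at h
    rw [map_sub, map_smul, hP]
    simp only [smul_apply]
    rw [RCLike.ofReal_add ω, add_smul] at h
    refine Eq.trans ?_ (congrArg (· + (R (ω + (n + 1)) (A ψ) - (ω : 𝕜) • R (ω + (n + 1)) ψ)) h)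
    abel
  have hP1 : ∀ f, Tendsto (fun n => P n f) atTop (𝓝 f) := by
    refine tendsto_apply_of_dense (L' := ContinuousLinearMap.id 𝕜 E) hPb hdense fun ψ hψ => ?_
    have h0 : Tendsto (fun n : ℕ => ((n : ℝ) + 1)⁻¹ * ‖A ⟨ψ, hψ⟩ - (ω : 𝕜) • ψ‖) atTop (𝓝 0) := by
      have := (tendsto_one_div_add_atTop_nhds_zero_nat (𝕜 := ℝ)).mul_const
        ‖A ⟨ψ, hψ⟩ - (ω : 𝕜) • ψ‖
      simpa using this
    rw [tendsto_iff_norm_sub_tendsto_zero]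
    refine squeeze_zero (fun n => norm_nonneg _) (fun n => ?_) h0
    rw [hid n ⟨ψ, hψ⟩, ContinuousLinearMap.id_apply, add_sub_cancel_left]
    exact ContinuousLinearMap.le_of_opNorm_le _ (hbn n) _
  have h2 := (hP1 (A φ - (ω : 𝕜) • (φ : E))).add_const ((ω : 𝕜) • (φ : E))
  rw [sub_add_cancel] at h2
  refine h2.congr fun n => ?_
  have h3 := hid n φ
  have h4 : P n (A φ - (ω : 𝕜) • (φ : E)) = ((n + 1 : ℝ) : 𝕜) • (P n φ - φ) := by
    rw [h3, add_sub_cancel_left]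
    simp [hP]
  rw [h4, yosidaApprox, yosidaPart, hP]
  simp only [smul_apply]
  rw [smul_sub, smul_smul]
  push_cast
  rw [sub_smul, sq]
  abel

variable [CompleteSpace E] [NormedSpace ℝ E] [IsScalarTower ℝ 𝕜 E]

/-- The Hille–Yosida theorem for resolvents with `‖R(λ)‖ ≤ 1 / (λ - ω)`; the semigroup is the limit
of the semigroups of the Yosida approximations. -/
theorem hilleYosida {A : E →ₗ.[𝕜] E} {ω : ℝ} (hω : 0 ≤ ω) (hdense : Dense (A.domain : Set E))
    {R : ℝ → E →L[𝕜] E} (hR : ∀ lam : ℝ, ω < lam → IsResolventAt A (lam : 𝕜) (R lam))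
    (hb : ∀ lam, ω < lam → ‖R lam‖ ≤ (lam - ω)⁻¹) :
    ∃ V : C0Semigroup 𝕜 E, V.generator = A ∧
      ∀ (t : ℝ≥0) (f : E), Tendsto (fun n => yosidaOp R ω n t f) atTop (𝓝 (V.op t f)) := by
  have hpos : ∀ n : ℕ, (0 : ℝ) < n + 1 := fun n => by positivity
  have hcomm : ∀ m n : ℕ, Commute (yosidaPart R ω (m + 1)) (yosidaPart R ω (n + 1)) := fun m n =>
    (((hR _ (by linarith [hpos m])).comm (hR _ (by linarith [hpos n]))).smul_left _).smul_right _
  have hgr := norm_yosidaPart_le hb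
  have hlim := tendsto_yosidaApprox hdense hR hb
  have hSb : ∀ (n : ℕ) {t : ℝ}, 0 ≤ t → ‖yosidaOp R ω n t‖ ≤ Real.exp (ω * t) := fun n t ht =>
    (norm_expOp_le _ _ ht).trans (Real.exp_le_exp.2 (mul_le_mul_of_nonneg_right (hgr n) ht))
  have hcau : ∀ (t : ℝ≥0) (f : E), CauchySeq fun n => yosidaOp R ω n t f := by
    intro t
    refine cauchySeq_apply_of_dense (fun n => hSb n t.coe_nonneg) hdense fun f hf => ?_
    have hc := Metric.cauchySeq_iff.1 (hlim ⟨f, hf⟩).cauchySeq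
    rw [Metric.cauchySeq_iff]
    intro ε hε
    set K := Real.exp (ω * t) * t + 1 with hK
    have hKpos : 0 < K := by positivity
    obtain ⟨N, hN⟩ := hc (ε / K) (by positivity)
    refine ⟨N, fun m hm n hn => ?_⟩
    have h1 := hN m hm n hn
    rw [dist_eq_norm] at h1 ⊢
    calc _ ≤ Real.exp (ω * t) * t * ‖yosidaApprox R ω m f - yosidaApprox R ω n f‖ :=
          norm_expOp_sub_le (hcomm m n) (hgr m) (hgr n) t.coe_nonneg f
      _ ≤ K * ‖yosidaApprox R ω m f - yosidaApprox R ω n f‖ := by gcongr; rw [hK]; linarith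
      _ < K * (ε / K) := by gcongr
      _ = ε := by field_simp
  choose v hv using fun t f => cauchySeq_tendsto_of_complete (hcau t f)
  set W : ℝ≥0 → E →L[𝕜] E := fun t =>
    continuousLinearMapOfTendsto (fun n => yosidaOp R ω n t) (tendsto_pi_nhds.2 (hv t)) with hW
  have hWt : ∀ (t : ℝ≥0) (f : E), Tendsto (fun n => yosidaOp R ω n t f) atTop (𝓝 (W t f)) := hv
  have hWb : ∀ t : ℝ≥0, ‖W t‖ ≤ Real.exp (ω * t) := fun t =>
    ContinuousLinearMap.opNorm_le_bound _ (Real.exp_pos _).le fun f =>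
      le_of_tendsto' (hWt t f).norm fun n => (yosidaOp R ω n t).le_of_opNorm_le
        (hSb n t.coe_nonneg) f
  -- uniform boundedness allows the argument to vary with `n` as well
  have hcomp : ∀ (t : ℝ≥0) (x : ℕ → E) (y : E), Tendsto x atTop (𝓝 y) →
      Tendsto (fun n => yosidaOp R ω n t (x n)) atTop (𝓝 (W t y)) := by
    intro t x y hxy
    have h1 : Tendsto (fun n => yosidaOp R ω n t (x n - y)) atTop (𝓝 0) := by
      rw [tendsto_zero_iff_norm_tendsto_zero]
      have : Tendsto (fun n => Real.exp (ω * t) * ‖x n - y‖) atTop (𝓝 0) := by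
        simpa using (hxy.sub_const y).norm.const_mul (Real.exp (ω * t))
      exact squeeze_zero (fun n => norm_nonneg _)
        (fun n => ContinuousLinearMap.le_of_opNorm_le _ (hSb n t.coe_nonneg) _) this
    have h2 := h1.add (hWt t y)
    rw [zero_add] at h2
    exact h2.congr fun n => by rw [map_sub, sub_add_cancel]
  have hW0 : W 0 = ContinuousLinearMap.id 𝕜 E := by
    ext f
    refine tendsto_nhds_unique (hWt 0 f) ?_
    simp [yosidaOp, expOp_zero]
  have hWadd : ∀ s t : ℝ≥0, W (s + t) = (W s).comp (W t) := by
    intro s t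
    ext f
    refine tendsto_nhds_unique (hWt (s + t) f) ((hcomp s _ _ (hWt t f)).congr fun n => ?_)
    simp [yosidaOp, expOp_add]
  have hcont : ∀ f ∈ (A.domain : Set E), Tendsto (fun t => W t f) (𝓝 0) (𝓝 f) := by
    intro f hf
    have hle : ∀ t : ℝ≥0, ‖W t f - f‖ ≤ Real.exp (ω * t) * t * ‖A ⟨f, hf⟩‖ := by
      intro t
      refine le_of_tendsto_of_tendsto' ((hWt t f).sub_const f).norm
        ((hlim ⟨f, hf⟩).norm.const_mul _) fun n => ?_
      have := norm_expOp_sub_le (Commute.zero_right (yosidaPart R ω (n + 1))) (c' := 0) (hgr n)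
        (by simpa using hω) t.coe_nonneg f
      simpa [yosidaApprox, yosidaOp, expOp] using this
    rw [tendsto_iff_norm_sub_tendsto_zero]
    refine squeeze_zero (fun t => norm_nonneg _) hle ?_
    have : Continuous fun t : ℝ≥0 => Real.exp (ω * t) * t * ‖A ⟨f, hf⟩‖ := by fun_prop
    simpa using this.tendsto 0
  let V : C0Semigroup 𝕜 E := C0Semigroup.ofDense W hW0 hWadd ω hω hWb _ hdense hcont
  have hVop : ∀ t, V.op t = W t := fun t => rfl
  refine ⟨V, ?_, hWt⟩
  have hgen : ∀ φ : A.domain, V.HasGenerator φ (A φ) := by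
    intro φ
    have hc : Continuous fun u : ℝ => W u.toNNReal (A φ) :=
      (V.continuous_orbit (A φ)).comp continuous_real_toNNReal
    refine C0Semigroup.HasGenerator.of_hasDerivAt
      (u := fun t => (φ : E) + ∫ u in (0 : ℝ)..t, W u.toNNReal (A φ)) ?_ fun t => ?_
    · have := ((hc.integral_hasStrictDerivAt 0 0).hasDerivAt).const_add (φ : E)
      simpa [hW0] using this
    · obtain ⟨C, hC⟩ := (hlim φ).norm.bddAbove_range
      have hC' : ∀ n, ‖yosidaApprox R ω n φ‖ ≤ C := fun n => hC ⟨n, rfl⟩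
      have hFTC : ∀ n, yosidaOp R ω n t φ - φ =
          ∫ u in (0 : ℝ)..t, yosidaOp R ω n u (yosidaApprox R ω n φ) := by
        intro n
        have hd : ∀ u, HasDerivAt (fun u => yosidaOp R ω n u φ)
            (yosidaOp R ω n u (yosidaApprox R ω n φ)) u := fun u => hasDerivAt_expOp_apply _ _ _ _
        have hcn : Continuous fun u => yosidaOp R ω n u (yosidaApprox R ω n φ) :=
          continuous_iff_continuousAt.2 fun u => (hasDerivAt_expOp_apply _ _ u _).continuousAt
        rw [intervalIntegral.integral_eq_sub_of_hasDerivAt (fun u _ => hd u)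
          (hcn.intervalIntegrable _ _)]
        simp [yosidaOp, expOp_zero]
      have hI : Tendsto (fun n => ∫ u in (0 : ℝ)..t, yosidaOp R ω n u (yosidaApprox R ω n φ)) atTop
          (𝓝 (∫ u in (0 : ℝ)..t, W u.toNNReal (A φ))) := by
        refine intervalIntegral.tendsto_integral_filter_of_dominated_convergence
          (fun u => Real.exp (ω * u) * C) ?_ ?_ ?_ ?_
        · refine Eventually.of_forall fun n => Continuous.aestronglyMeasurable ?_
          exact continuous_iff_continuousAt.2 fun u => (hasDerivAt_expOp_apply _ _ u _).continuousAt
        · refine Eventually.of_forall fun n => ae_of_all _ fun u hu => ?_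
          rw [uIoc_of_le t.coe_nonneg] at hu
          exact (ContinuousLinearMap.le_of_opNorm_le _ (hSb n hu.1.le) _).trans
            (by gcongr; exact hC' n)
        · exact Continuous.intervalIntegrable (by fun_prop) _ _
        · refine ae_of_all _ fun u hu => ?_
          rw [uIoc_of_le t.coe_nonneg] at hu
          have := hcomp u.toNNReal _ _ (hlim φ)
          rwa [Real.coe_toNNReal u hu.1.le] at this
      have h1 := (hWt t φ).sub_const (φ : E)
      simp_rw [hFTC] at h1
      rw [hVop, ← tendsto_nhds_unique h1 hI]
      abel
  obtain ⟨R', -, hR'⟩ := C0Semigroup.exists_resolvent (S := V) (lam := ω + 1) hWb (by linarith)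
  refine ((hR (ω + 1) (by linarith)).eq_of_le hR' ⟨fun φ hφ => (hgen ⟨φ, hφ⟩).mem_domain, ?_⟩).symm
  intro φ ψ h
  have hψ : V.HasGenerator ψ (A φ) := h ▸ hgen φ
  exact (hψ.generator_eq ψ.2).symm

end HilleYosida

/-! ### The characteristic flow -/

/-- The data of the growth flow `dx/dt = r(x)` with absorption rate `a`: the travel time
`s(y) = ∫_0^y 1/r`, extended to an order isomorphism of the line, the accumulated absorption
`A(y) - A(x) = ∫_x^y a/r`, and the linear bound on the growth rate. -/
structure IsFlow (r a : ℝ → ℝ) (s : ℝ ≃o ℝ) (A : ℝ → ℝ) (C : ℝ) : Prop where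
  r_cont : ContinuousOn r (Ioi 0)
  r_pos : ∀ x, 0 < x → 0 < r x
  r_le : ∀ x, 0 < x → r x ≤ C * (1 + x)
  a_meas : AEMeasurable a (volume.restrict (Ioi 0))
  a_nonneg : ∀ x, 0 < x → 0 ≤ a x
  time_zero : s 0 = 0
  time_integral : ∀ x y, 0 ≤ x → x ≤ y → ∫ τ in x..y, 1 / r τ = s y - s x
  time_deriv : ∀ x, 0 < x → HasDerivAt s (r x)⁻¹ x
  loss_cont : ContinuousOn A (Ioi 0)
  loss_mono : MonotoneOn A (Ioi 0)
  loss_integral : ∀ x y, 0 < x → x ≤ y → ∫ p in x..y, a p / r p = A y - A x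
  loss_deriv : ∀ᵐ x ∂(volume.restrict (Ioi (0 : ℝ))), HasDerivAt A (a x / r x) x

section Existence

variable {r a : ℝ → ℝ}

theorem exists_travelTime (hr_cont : ContinuousOn r (Ioi 0)) (hr_pos : ∀ x, 0 < x → 0 < r x)
    (hr_zero : IntegrableOn (fun τ => 1 / r τ) (Ioc 0 1))
    (hr_top : ¬ IntegrableOn (fun τ => 1 / r τ) (Ioi 1)) :
    ∃ s : ℝ ≃o ℝ, s 0 = 0 ∧ (∀ x y, 0 ≤ x → x ≤ y → ∫ τ in x..y, 1 / r τ = s y - s x) ∧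
      ∀ x, 0 < x → HasDerivAt s (r x)⁻¹ x := by
  have hinv : ContinuousOn (fun τ => 1 / r τ) (Ioi 0) :=
    continuousOn_const.div hr_cont fun x hx => (hr_pos x hx).ne'
  -- the integrand is extended by `1` to the left of `0`, so that the travel time becomes a bijection
  -- of the whole line
  set q : ℝ → ℝ := fun τ => if 0 < τ then 1 / r τ else 1 with hq
  have hqpos : ∀ x, 0 < q x := fun x => by
    simp only [hq]
    split_ifs with h
    · exact one_div_pos.2 (hr_pos x h)
    · exact one_pos
  have hIoc : ∀ y, 1 ≤ y → IntegrableOn (fun τ => 1 / r τ) (Ioc 0 y) := fun y hy => by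
    rw [← Ioc_union_Icc_eq_Ioc zero_lt_one hy]
    refine hr_zero.union ((hinv.mono fun x hx => ?_).integrableOn_compact isCompact_Icc)
    exact lt_of_lt_of_le zero_lt_one hx.1
  have hint0 : ∀ y, IntervalIntegrable q volume 0 y := fun y => by
    rcases le_total y 0 with h | h
    · refine (intervalIntegrable_const (c := (1 : ℝ))).congr fun x hx => ?_
      rw [uIoc_of_ge h] at hx
      simp [hq, not_lt.2 hx.2]
    · rw [intervalIntegrable_iff_integrableOn_Ioc_of_le h]
      refine IntegrableOn.congr_fun ((hIoc (max y 1) (le_max_right _ _)).mono_set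
        (Ioc_subset_Ioc_right (le_max_left _ _))) (fun x hx => ?_) measurableSet_Ioc
      simp [hq, hx.1]
  have hint : ∀ x y, IntervalIntegrable q volume x y := fun x y => (hint0 x).symm.trans (hint0 y)
  set S : ℝ → ℝ := fun y => ∫ τ in (0 : ℝ)..y, q τ with hS
  have hSsub : ∀ x y, ∫ τ in x..y, q τ = S y - S x := fun x y => by
    rw [hS, intervalIntegral.integral_interval_sub_left (hint 0 y) (hint 0 x)]
  have hmono : StrictMono S := fun x y hxy => by
    have := intervalIntegral.intervalIntegral_pos_of_pos (hint x y) hqpos hxy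
    rw [hSsub] at this
    linarith
  have hcont : Continuous S := intervalIntegral.continuous_primitive hint 0
  have hbot : Tendsto S atBot atBot := by
    refine tendsto_id.congr' ?_
    filter_upwards [eventually_le_atBot (0 : ℝ)] with y hy
    have : S y = ∫ τ in (0 : ℝ)..y, (1 : ℝ) := by
      refine intervalIntegral.integral_congr_ae (ae_of_all _ fun x hx => ?_)
      rw [uIoc_of_ge hy] at hx
      simp [hq, not_lt.2 hx.2]
    simp [this]
  have heq : ∀ x y, 0 ≤ x → x ≤ y → ∫ τ in x..y, 1 / r τ = S y - S x := fun x y hx hxy => by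
    rw [← hSsub]
    refine intervalIntegral.integral_congr_ae (ae_of_all _ fun z hz => ?_)
    rw [uIoc_of_le hxy] at hz
    simp [hq, hx.trans_lt hz.1]
  have htop : Tendsto S atTop atTop := by
    refine tendsto_atTop_atTop_of_monotone hmono.monotone fun b => ?_
    by_contra! hlt
    refine hr_top (integrableOn_Ioi_of_intervalIntegral_norm_bounded (l := atTop) (b := id)
      (b - S 1) 1 (fun y => ?_) tendsto_id ?_)
    · rcases le_total y 1 with h | h
      · simp [Ioc_eq_empty (not_lt.2 h)]
      · exact (hIoc y h).mono_set (Ioc_subset_Ioc_left zero_le_one)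
    · filter_upwards [eventually_ge_atTop (1 : ℝ)] with y hy
      have : ∫ x in (1 : ℝ)..id y, ‖1 / r x‖ = ∫ x in (1 : ℝ)..y, 1 / r x := by
        refine intervalIntegral.integral_congr_ae (ae_of_all _ fun z hz => ?_)
        rw [id, uIoc_of_le hy] at hz
        exact Real.norm_of_nonneg (one_div_pos.2 (hr_pos z (zero_lt_one.trans hz.1))).le
      rw [this, heq 1 y zero_le_one hy]
      linarith [hlt y]
  refine ⟨hmono.orderIsoOfSurjective S (hcont.surjective htop hbot), ?_, heq, fun x hx => ?_⟩
  · simp [hS]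
  · have hqx : q =ᶠ[𝓝 x] fun τ => 1 / r τ := by
      filter_upwards [Ioi_mem_nhds hx] with τ hτ
      simp [hq, show (0 : ℝ) < τ from hτ]
    have hqc : ContinuousOn q (Ioi 0) := hinv.congr fun τ hτ => by
      simp [hq, show (0 : ℝ) < τ from hτ]
    have hd : HasDerivAt S (q x) x := intervalIntegral.integral_hasDerivAt_right (hint 0 x)
      (hqc.stronglyMeasurableAtFilter isOpen_Ioi x hx) (hqc.continuousAt (Ioi_mem_nhds hx))
    rw [hqx.self_of_nhds] at hd
    simp only [one_div] at hd
    exact hd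

theorem exists_loss (hr_cont : ContinuousOn r (Ioi 0)) (hr_pos : ∀ x, 0 < x → 0 < r x)
    (ha_loc : LocallyIntegrableOn a (Ioi 0)) (ha_nonneg : ∀ y, 0 < y → 0 ≤ a y) :
    ∃ A : ℝ → ℝ, ContinuousOn A (Ioi 0) ∧ MonotoneOn A (Ioi 0) ∧
      (∀ x y, 0 < x → x ≤ y → ∫ p in x..y, a p / r p = A y - A x) ∧
      ∀ᵐ x ∂(volume.restrict (Ioi (0 : ℝ))), HasDerivAt A (a x / r x) x := by
  have hinv : ContinuousOn (fun τ => (r τ)⁻¹) (Ioi 0) :=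
    hr_cont.inv₀ fun x hx => (hr_pos x hx).ne'
  have hint : ∀ x y, 0 < x → 0 < y → IntervalIntegrable (fun p => a p / r p) volume x y := by
    intro x y hx hy
    have hsub : uIcc x y ⊆ Ioi 0 := fun z hz => lt_of_lt_of_le (lt_min hx hy) hz.1
    rw [intervalIntegrable_iff']
    simp only [div_eq_mul_inv]
    exact (ha_loc.integrableOn_compact_subset hsub isCompact_uIcc).mul_continuousOn
      (hinv.mono hsub) isCompact_uIcc
  set A : ℝ → ℝ := fun y => ∫ p in (1 : ℝ)..y, a p / r p with hA
  have hsub : ∀ x y, 0 < x → 0 < y → ∫ p in x..y, a p / r p = A y - A x := fun x y hx hy => by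
    rw [hA, intervalIntegral.integral_interval_sub_left (hint 1 y one_pos hy) (hint 1 x one_pos hx)]
  refine ⟨A, fun x hx => ?_, fun x hx y hy hxy => ?_, fun x y hx hxy => hsub x y hx (hx.trans_le hxy),
    ?_⟩
  · have hx0 : 0 < x := hx
    have h1 : (1 : ℝ) ∈ uIcc (min (x / 2) 1) (max (x + 1) 1) :=
      ⟨by simp, by simp⟩
    have := intervalIntegral.continuousOn_primitive_interval' (hint (min (x / 2) 1) (max (x + 1) 1)
      (by positivity) (by positivity)) h1
    refine (this.continuousAt ?_).continuousWithinAt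
    have hlt : min (x / 2) 1 < x := (min_le_left _ _).trans_lt (by linarith)
    have hgt : x < max (x + 1) 1 := lt_of_lt_of_le (by linarith) (le_max_left _ _)
    rw [uIcc_of_le (hlt.trans hgt).le]
    exact Icc_mem_nhds hlt hgt
  · have hx0 : 0 < x := hx
    rw [← sub_nonneg, ← hsub x y hx hy]
    refine intervalIntegral.integral_nonneg hxy fun u hu => ?_
    have hu0 := hx0.trans_le hu.1
    exact div_nonneg (ha_nonneg u hu0) (hr_pos u hu0).le
  · have h : ∀ n : ℕ, ∀ᵐ x, x ∈ uIcc ((n + 1 : ℝ)⁻¹) (n + 1) →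
        ∀ c ∈ uIcc ((n + 1 : ℝ)⁻¹) (n + 1),
          HasDerivAt (fun x => ∫ p in c..x, a p / r p) (a x / r x) x := fun n =>
      (hint _ _ (by positivity) (by positivity)).ae_hasDerivAt_integral
    filter_upwards [ae_restrict_of_ae (ae_all_iff.2 h), ae_restrict_mem measurableSet_Ioi]
      with x hx hx0
    have hx0' : 0 < x := hx0
    obtain ⟨n, hn⟩ := exists_nat_ge (max x x⁻¹)
    have hn1 : (1 : ℝ) ≤ n + 1 := by simp
    have hle : ((n : ℝ) + 1)⁻¹ ≤ n + 1 := (inv_le_one_of_one_le₀ hn1).trans hn1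
    refine hx n ?_ 1 ?_
    · rw [uIcc_of_le hle]
      refine ⟨inv_le_of_inv_le₀ hx0' ?_, ?_⟩
      · linarith [(le_max_right x x⁻¹).trans hn]
      · linarith [(le_max_left x x⁻¹).trans hn]
    · rw [uIcc_of_le hle]
      exact ⟨inv_le_one_of_one_le₀ hn1, hn1⟩

end Existence

/-- The position `Y(x, t)` at time `t` of the characteristic starting at `x`, and, for negative `t`,
the foot `X(y, -t)` of the characteristic through `y`. -/
def flow (s : ℝ ≃o ℝ) (t x : ℝ) : ℝ := s.symm (s x + t)

namespace IsFlow

variable {r a : ℝ → ℝ} {s : ℝ ≃o ℝ} {A : ℝ → ℝ} {C : ℝ}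

theorem time_pos (F : IsFlow r a s A C) {x : ℝ} (hx : 0 < x) : 0 < s x := by
  rw [← F.time_zero]; exact s.strictMono hx

theorem symm_pos (F : IsFlow r a s A C) {σ : ℝ} (hσ : 0 < σ) : 0 < s.symm σ := by
  have : s.symm 0 = 0 := by rw [← F.time_zero, s.symm_apply_apply, F.time_zero]
  rw [← this]; exact s.symm.strictMono hσ

theorem C_pos (F : IsFlow r a s A C) : 0 < C := by
  have := (F.r_pos 1 one_pos).trans_le (F.r_le 1 one_pos)
  linarith

theorem flow_flow (s : ℝ ≃o ℝ) (t u x : ℝ) : flow s t (flow s u x) = flow s (u + t) x := by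
  simp [flow, add_assoc]

theorem flow_zero (s : ℝ ≃o ℝ) (x : ℝ) : flow s 0 x = x := by simp [flow]

theorem flow_neg_flow (s : ℝ ≃o ℝ) (t x : ℝ) : flow s (-t) (flow s t x) = x := by
  rw [flow_flow, add_neg_cancel, flow_zero]

theorem time_flow (s : ℝ ≃o ℝ) (t x : ℝ) : s (flow s t x) = s x + t := by simp [flow]

theorem continuous_flow (s : ℝ ≃o ℝ) (t : ℝ) : Continuous (flow s t) := by
  unfold flow
  exact s.symm.continuous.comp (s.continuous.add continuous_const)

theorem continuous_flow_time (s : ℝ ≃o ℝ) (x : ℝ) : Continuous fun t => flow s t x := by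
  unfold flow
  exact s.symm.continuous.comp (by fun_prop)

theorem le_flow (s : ℝ ≃o ℝ) {t : ℝ} (ht : 0 ≤ t) (x : ℝ) : x ≤ flow s t x := by
  rw [← s.le_iff_le, time_flow]; linarith

theorem flow_pos (F : IsFlow r a s A C) {t x : ℝ} (h : 0 < s x + t) : 0 < flow s t x :=
  F.symm_pos h

theorem flow_pos_of_nonneg (s : ℝ ≃o ℝ) {t x : ℝ} (ht : 0 ≤ t) (hx : 0 < x) :
    0 < flow s t x := hx.trans_le (le_flow s ht x)

theorem hasDerivAt_symm (F : IsFlow r a s A C) {σ : ℝ} (hσ : 0 < σ) :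
    HasDerivAt s.symm (r (s.symm σ)) σ := by
  have hp := F.symm_pos hσ
  have := HasDerivAt.of_local_left_inverse (f := s) (g := s.symm) (a := σ)
    s.symm.continuous.continuousAt (F.time_deriv _ hp) (inv_ne_zero (F.r_pos _ hp).ne')
    (Eventually.of_forall fun x => s.apply_symm_apply x)
  simpa using this

theorem hasDerivAt_flow (F : IsFlow r a s A C) {t x : ℝ} (hx : 0 < x) (h : 0 < s x + t) :
    HasDerivAt (flow s t) (r (flow s t x) / r x) x := by
  have := (F.hasDerivAt_symm h).comp x ((F.time_deriv x hx).add_const t)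
  rw [div_eq_mul_inv]
  exact this

theorem hasDerivAt_flow_time (F : IsFlow r a s A C) {x : ℝ} (hx : 0 < x) :
    HasDerivAt (fun t => flow s t x) (r x) 0 := by
  have h : HasDerivAt s.symm (r x) (s x + 0) := by
    simpa using F.hasDerivAt_symm (F.time_pos hx)
  have h2 := h.comp (0 : ℝ) ((hasDerivAt_id (0 : ℝ)).const_add (s x))
  rw [mul_one] at h2
  exact h2

/-- Sublinearity of the growth rate gives exponential growth along characteristics. -/
theorem one_add_flow_le (F : IsFlow r a s A C) {t x : ℝ} (ht : 0 ≤ t) (hx : 0 < x) :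
    1 + flow s t x ≤ Real.exp (C * t) * (1 + x) := by
  -- `log (1 + y) - C s(y)` decreases, while `s` grows by exactly `t` along the characteristic
  have hd : ∀ y ∈ Ioi (0 : ℝ), HasDerivAt (fun y => Real.log (1 + y) - C * s y)
      (1 / (1 + y) - C * (r y)⁻¹) y := by
    intro y hy
    have hy0 : (0 : ℝ) < y := hy
    exact (((hasDerivAt_id y).const_add 1).log (by simp only [id]; positivity)).sub
      ((F.time_deriv y hy).const_mul C)
  have hanti : AntitoneOn (fun y => Real.log (1 + y) - C * s y) (Ioi 0) := by
    refine antitoneOn_of_deriv_nonpos (convex_Ioi 0)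
      (fun y hy => (hd y hy).continuousAt.continuousWithinAt) ?_ ?_
    · rw [interior_Ioi]
      exact fun y hy => (hd y hy).differentiableAt.differentiableWithinAt
    · rw [interior_Ioi]
      intro y hy
      have hy0 : (0 : ℝ) < y := hy
      rw [(hd y hy).deriv, sub_nonpos, ← div_eq_mul_inv,
        div_le_div_iff₀ (by positivity) (F.r_pos y hy), one_mul]
      exact F.r_le y hy
  have hY := flow_pos_of_nonneg s ht hx
  have h := hanti hx hY (le_flow s ht x)
  simp only [time_flow] at h
  have h2 : Real.log (1 + flow s t x) ≤ Real.log (1 + x) + C * t := by linarith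
  rw [← Real.exp_le_exp, Real.exp_add, Real.exp_log (by positivity), Real.exp_log (by positivity)]
    at h2
  linarith

end IsFlow

/-! ### The weighted space -/

section Weight

variable {𝕜 : Type*} [RCLike 𝕜] {α : ℝ}

theorem ae_weight_iff {p : ℝ → Prop} :
    (∀ᵐ x ∂(weight α), p x) ↔ ∀ᵐ x ∂(volume.restrict (Ioi (0 : ℝ))), p x :=
  ⟨ae_volume_of_ae_weight, fun h => (withDensity_absolutelyContinuous _ _) h⟩

theorem lintegral_weight (G : ℝ → ℝ≥0∞) :
    ∫⁻ x, G x ∂(weight α) = ∫⁻ x in Ioi (0 : ℝ), ENNReal.ofReal ((1 + x) ^ α) * G x := by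
  rw [weight, lintegral_withDensity_eq_lintegral_mul_non_measurable _ (by fun_prop)
    (ae_of_all _ fun x => ENNReal.ofReal_lt_top)]
  rfl

theorem ofReal_norm_eq (f : X₀ 𝕜 α) : ENNReal.ofReal ‖f‖ = ∫⁻ x, ‖f x‖ₑ ∂(weight α) :=
  L1.ofReal_norm_eq_lintegral f

theorem norm_le_of_lintegral_le {f : X₀ 𝕜 α} {c : ℝ} (hc : 0 ≤ c)
    (h : ∫⁻ x, ‖f x‖ₑ ∂(weight α) ≤ ENNReal.ofReal c) : ‖f‖ ≤ c := by
  rw [← ofReal_norm_eq] at h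
  exact (ENNReal.ofReal_le_ofReal_iff hc).1 h

theorem isLocallyFiniteMeasure_weight (hα : 0 ≤ α) : IsLocallyFiniteMeasure (weight α) := by
  refine IsLocallyFiniteMeasure.withDensity_ofReal ?_
  exact (continuous_const.add continuous_id).rpow_const fun x => Or.inr hα

/-- The functions with a continuous representative are dense in the weighted space. -/
theorem dense_continuous (hα : 0 ≤ α) :
    Dense {f : X₀ 𝕜 α | ∃ g : ℝ → 𝕜, Continuous g ∧ f =ᵐ[weight α] g} := by
  have := isLocallyFiniteMeasure_weight hα
  rw [Metric.dense_iff]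
  intro f ε hε
  obtain ⟨g, -, hfg, hgc, hg⟩ := (Lp.memLp f).exists_hasCompactSupport_eLpNorm_sub_le
    ENNReal.one_ne_top (ε := ENNReal.ofReal (ε / 2)) (by simpa using hε)
  refine ⟨hg.toLp g, ?_, g, hgc, hg.coeFn_toLp⟩
  rw [Metric.mem_ball, dist_comm, dist_eq_norm]
  refine lt_of_le_of_lt ?_ (half_lt_self hε)
  rw [Lp.norm_def]
  refine ENNReal.toReal_le_of_le_ofReal (by positivity) (le_of_eq_of_le ?_ hfg)
  refine eLpNorm_congr_ae ?_
  filter_upwards [Lp.coeFn_sub f (hg.toLp g), hg.coeFn_toLp] with x h1 h2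
  rw [h1, Pi.sub_apply, Pi.sub_apply, h2]

/-- Scheffé's lemma: almost everywhere convergence together with convergence of the norms implies
convergence in `L¹`. -/
theorem tendsto_of_ae_tendsto_of_norm_le {X : Type*} [MeasurableSpace X] {μ : Measure X}
    {F : ℕ → Lp 𝕜 1 μ} {f : Lp 𝕜 1 μ}
    (hae : ∀ᵐ x ∂μ, Tendsto (fun n => F n x) atTop (𝓝 (f x))) {c : ℕ → ℝ}
    (hc : Tendsto c atTop (𝓝 1)) (hle : ∀ n, ‖F n‖ ≤ c n * ‖f‖) :
    Tendsto F atTop (𝓝 f) := by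
  have hi : ∀ g : Lp 𝕜 1 μ, Integrable (fun x => ‖g x‖) μ := fun g =>
    (L1.integrable_coeFn g).norm
  -- the defect in the triangle inequality is dominated by `2 ‖f‖`
  have hdom : Tendsto (fun n => ∫ x, (‖F n x - f x‖ - ‖F n x‖ + ‖f x‖) ∂μ) atTop
      (𝓝 (∫ x, (0 : ℝ) ∂μ)) := by
    refine tendsto_integral_of_dominated_convergence (fun x => 2 * ‖f x‖) (fun n => ?_)
      ((hi f).const_mul 2) (fun n => ae_of_all _ fun x => ?_) ?_
    · have h1 := (Lp.aestronglyMeasurable (F n))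
      have h2 := (Lp.aestronglyMeasurable f)
      exact ((h1.sub h2).norm.sub h1.norm).add h2.norm
    · have h1 := norm_sub_le (F n x) (f x)
      have h2 := norm_le_norm_sub_add (F n x) (f x)
      rw [Real.norm_of_nonneg (by linarith)]
      linarith
    · filter_upwards [hae] with x hx
      have := ((hx.sub_const (f x)).norm.sub hx.norm).add_const ‖f x‖
      simpa using this
  rw [integral_zero] at hdom
  rw [tendsto_iff_norm_sub_tendsto_zero]
  have hlim : Tendsto (fun n => (c n - 1) * ‖f‖ +
      ∫ x, (‖F n x - f x‖ - ‖F n x‖ + ‖f x‖) ∂μ) atTop (𝓝 0) := by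
    simpa using ((hc.sub_const 1).mul_const ‖f‖).add hdom
  refine squeeze_zero (fun n => norm_nonneg _) (fun n => ?_) hlim
  have hsub : Integrable (fun x => ‖F n x - f x‖) μ :=
    ((L1.integrable_coeFn (F n)).sub (L1.integrable_coeFn f)).norm
  have e : ‖F n - f‖ = ∫ x, ‖F n x - f x‖ ∂μ := by
    rw [L1.norm_eq_integral_norm]
    refine integral_congr_ae ?_
    filter_upwards [Lp.coeFn_sub (F n) f] with x hx
    rw [hx, Pi.sub_apply]
  have e2 : ∫ x, (‖F n x - f x‖ - ‖F n x‖ + ‖f x‖) ∂μ = ‖F n - f‖ - ‖F n‖ + ‖f‖ := by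
    have h1 := integral_add (hsub.sub (hi (F n))) (hi f)
    have h2 := integral_sub hsub (hi (F n))
    rw [e, L1.norm_eq_integral_norm, L1.norm_eq_integral_norm, ← h2]
    exact h1
  rw [e2]
  linarith [hle n]

end Weight

/-! ### The transport semigroup -/

/-- The function `U(t) f`: transport of the density `f` along the characteristics during time `t`,
with loss. -/
def transport {𝕜 : Type*} [RCLike 𝕜] (r : ℝ → ℝ) (s : ℝ ≃o ℝ) (A : ℝ → ℝ) (t : ℝ) (f : ℝ → 𝕜)
    (y : ℝ) : 𝕜 :=
  if t < s y then
    ((Real.exp (-(A y - A (flow s (-t) y))) * (r (flow s (-t) y) / r y) : ℝ) : 𝕜) *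
      f (flow s (-t) y)
  else 0

namespace IsFlow

variable {𝕜 : Type*} [RCLike 𝕜] {r a : ℝ → ℝ} {s : ℝ ≃o ℝ} {A : ℝ → ℝ} {C : ℝ} {α : ℝ}

theorem flow_image (F : IsFlow r a s A C) (t : ℝ) :
    flow s t '' Ioi 0 = {y | t < s y} := by
  ext y
  constructor
  · rintro ⟨x, hx, rfl⟩
    have := F.time_pos hx
    simp only [mem_ofPred_eq, time_flow]
    linarith
  · intro hy
    have hy' : t < s y := hy
    refine ⟨flow s (-t) y, F.flow_pos (by linarith), ?_⟩
    rw [flow_flow, neg_add_cancel, flow_zero]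

theorem pos_of_lt_time (F : IsFlow r a s A C) {t y : ℝ} (ht : 0 ≤ t) (hy : t < s y) : 0 < y := by
  rw [← s.lt_iff_lt, F.time_zero]
  exact ht.trans_lt hy

theorem injective_flow (s : ℝ ≃o ℝ) (t : ℝ) : Function.Injective (flow s t) := fun x y h => by
  rw [← flow_neg_flow s t x, h, flow_neg_flow]

/-- The change of variables `y = Y(x, t)`. -/
theorem lintegral_transport (F : IsFlow r a s A C) {t : ℝ} (ht : 0 ≤ t) (f : ℝ → 𝕜)
    (G : ℝ → ℝ≥0∞) :
    ∫⁻ y in Ioi (0 : ℝ), G y * ‖transport r s A t f y‖ₑ =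
      ∫⁻ x in Ioi (0 : ℝ), G (flow s t x) *
        (ENNReal.ofReal (Real.exp (-(A (flow s t x) - A x))) * ‖f x‖ₑ) := by
  have hm : MeasurableSet {y | t < s y} := measurableSet_lt measurable_const s.continuous.measurable
  have h1 : ∫⁻ y in Ioi (0 : ℝ), G y * ‖transport r s A t f y‖ₑ =
      ∫⁻ y in {y | t < s y}, G y * ‖transport r s A t f y‖ₑ := by
    have e : (fun y => G y * ‖transport r s A t f y‖ₑ) =
        indicator {y | t < s y} fun y => G y * ‖transport r s A t f y‖ₑ := by
      ext y
      by_cases h : t < s y <;> simp [transport, indicator, h]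
    have hsub : {y | t < s y} ⊆ Ioi 0 := fun y hy => F.pos_of_lt_time ht hy
    rw [e, setLIntegral_indicator hm, ← e, inter_eq_left.2 hsub]
  rw [h1, ← F.flow_image t, lintegral_image_eq_lintegral_abs_deriv_mul measurableSet_Ioi
    (fun x hx => (F.hasDerivAt_flow hx (add_pos_of_pos_of_nonneg (F.time_pos hx) ht)).hasDerivWithinAt)
    (injective_flow s t).injOn]
  refine setLIntegral_congr_fun measurableSet_Ioi fun x hx => ?_
  have hx0 : 0 < x := hx
  have hY := flow_pos_of_nonneg s ht hx0
  have hrx := F.r_pos x hx0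
  have hrY := F.r_pos _ hY
  have hs : t < s (flow s t x) := by
    rw [time_flow]; linarith [F.time_pos hx0]
  simp only [transport, if_pos hs, flow_neg_flow, enorm_mul]
  have e : ‖((Real.exp (-(A (flow s t x) - A x)) * (r x / r (flow s t x)) : ℝ) : 𝕜)‖ₑ =
      ENNReal.ofReal (Real.exp (-(A (flow s t x) - A x))) *
        ENNReal.ofReal (r x / r (flow s t x)) := by
    rw [← ENNReal.ofReal_mul (Real.exp_pos _).le, ← ofReal_norm, RCLike.norm_ofReal,
      abs_of_pos (by positivity)]
  -- the Jacobian of the flow cancels the factor `r(X) / r(y)` of the transported density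
  have e2 : ENNReal.ofReal |r (flow s t x) / r x| * ENNReal.ofReal (r x / r (flow s t x)) = 1 := by
    rw [abs_of_pos (by positivity), ← ENNReal.ofReal_mul (by positivity)]
    rw [div_mul_div_cancel₀ hrx.ne', div_self hrY.ne', ENNReal.ofReal_one]
  rw [e]
  calc _ = (ENNReal.ofReal |r (flow s t x) / r x| * ENNReal.ofReal (r x / r (flow s t x))) *
        (G (flow s t x) * (ENNReal.ofReal (Real.exp (-(A (flow s t x) - A x))) * ‖f x‖ₑ)) := by
        ring
    _ = _ := by rw [e2, one_mul]

/-- The transport estimate before the surviving fraction is bounded by `1`; the absorption is read off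
from this form. -/
theorem lintegral_weight_transport_le (F : IsFlow r a s A C) (hα : 0 ≤ α) {t : ℝ} (ht : 0 ≤ t)
    (f : ℝ → 𝕜) :
    ∫⁻ y, ‖transport r s A t f y‖ₑ ∂(weight α) ≤
      ∫⁻ x, ENNReal.ofReal (Real.exp (α * C * t) * Real.exp (-(A (flow s t x) - A x))) * ‖f x‖ₑ
        ∂(weight α) := by
  rw [lintegral_weight, lintegral_weight, F.lintegral_transport ht]
  refine setLIntegral_mono' measurableSet_Ioi fun x hx => ?_
  have hx0 : 0 < x := hx
  have hw : (1 + flow s t x) ^ α ≤ Real.exp (α * C * t) * (1 + x) ^ α := by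
    calc (1 + flow s t x) ^ α ≤ (Real.exp (C * t) * (1 + x)) ^ α :=
          Real.rpow_le_rpow (by linarith [flow_pos_of_nonneg s ht hx0]) (F.one_add_flow_le ht hx0) hα
      _ = Real.exp (α * C * t) * (1 + x) ^ α := by
          rw [Real.mul_rpow (Real.exp_pos _).le (by linarith), ← Real.exp_mul]
          ring_nf
  calc _ ≤ ENNReal.ofReal (Real.exp (α * C * t) * (1 + x) ^ α) *
        (ENNReal.ofReal (Real.exp (-(A (flow s t x) - A x))) * ‖f x‖ₑ) := by gcongr
    _ = _ := by
        rw [ENNReal.ofReal_mul (Real.exp_pos _).le, ENNReal.ofReal_mul (Real.exp_pos _).le]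
        ring

theorem loss_flow_nonneg (F : IsFlow r a s A C) {t x : ℝ} (ht : 0 ≤ t) (hx : 0 < x) :
    0 ≤ A (flow s t x) - A x :=
  sub_nonneg.2 (F.loss_mono hx (flow_pos_of_nonneg s ht hx) (le_flow s ht x))

theorem lintegral_weight_transport_le' (F : IsFlow r a s A C) (hα : 0 ≤ α) {t : ℝ} (ht : 0 ≤ t)
    (f : ℝ → 𝕜) :
    ∫⁻ y, ‖transport r s A t f y‖ₑ ∂(weight α) ≤
      ENNReal.ofReal (Real.exp (α * C * t)) * ∫⁻ x, ‖f x‖ₑ ∂(weight α) := by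
  refine (F.lintegral_weight_transport_le hα ht f).trans ?_
  rw [← lintegral_const_mul' _ _ ENNReal.ofReal_ne_top]
  refine lintegral_mono_ae ?_
  filter_upwards [ae_weight_pos α] with x hx
  gcongr
  refine mul_le_of_le_one_right (Real.exp_pos _).le (Real.exp_le_one_iff.2 ?_)
  linarith [F.loss_flow_nonneg ht hx]

/-- The foot map pulls null sets back to null sets. -/
theorem ae_flow_neg (F : IsFlow r a s A C) {t : ℝ} (ht : 0 ≤ t) {p : ℝ → Prop}
    (h : ∀ᵐ x ∂(weight α), p x) : ∀ᵐ y ∂(weight α), t < s y → p (flow s (-t) y) := by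
  rw [ae_weight_iff, ae_restrict_iff' measurableSet_Ioi] at h ⊢
  have h0 : volume ({x | ¬ (x ∈ Ioi (0 : ℝ) → p x)}) = 0 := h
  have himg : volume (flow s t '' {x | ¬ (x ∈ Ioi (0 : ℝ) → p x)}) = 0 := by
    refine addHaar_image_eq_zero_of_differentiableOn_of_addHaar_eq_zero volume (fun x hx => ?_) h0
    have hx0 : (0 : ℝ) < x := by
      simp only [Classical.not_imp, mem_ofPred_eq] at hx
      exact hx.1
    exact (F.hasDerivAt_flow hx0
      (add_pos_of_pos_of_nonneg (F.time_pos hx0) ht)).differentiableAt.differentiableWithinAt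
  refine measure_mono_null (fun y hy => ?_) himg
  simp only [mem_compl_iff, mem_ofPred_eq, Classical.not_imp] at hy
  obtain ⟨-, hy1, hy2⟩ := hy
  refine ⟨flow s (-t) y, ?_, ?_⟩
  · simp only [mem_ofPred_eq, Classical.not_imp]
    exact ⟨F.flow_pos (by linarith), hy2⟩
  · rw [flow_flow, neg_add_cancel, flow_zero]

theorem transport_congr (F : IsFlow r a s A C) {t : ℝ} (ht : 0 ≤ t) {f g : ℝ → 𝕜}
    (h : f =ᵐ[weight α] g) : transport r s A t f =ᵐ[weight α] transport r s A t g := by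
  filter_upwards [F.ae_flow_neg ht h] with y hy
  simp only [transport]
  split_ifs with hty
  · rw [hy hty]
  · rfl

theorem aestronglyMeasurable_transport (F : IsFlow r a s A C) {t : ℝ} (ht : 0 ≤ t) {f : ℝ → 𝕜}
    (hf : StronglyMeasurable f) : AEStronglyMeasurable (transport r s A t f) (weight α) := by
  have hm : MeasurableSet {y | t < s y} := measurableSet_lt measurable_const s.continuous.measurable
  have e : transport r s A t f = indicator {y | t < s y} (fun y =>
      ((Real.exp (-(A y - A (flow s (-t) y))) * (r (flow s (-t) y) / r y) : ℝ) : 𝕜) *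
        f (flow s (-t) y)) := by
    ext y
    simp [transport, indicator]
  rw [e, aestronglyMeasurable_indicator_iff hm]
  have hmul : AEStronglyMeasurable (fun y =>
      ((Real.exp (-(A y - A (flow s (-t) y))) * (r (flow s (-t) y) / r y) : ℝ) : 𝕜))
      ((weight α).restrict {y | t < s y}) := by
    refine ContinuousOn.aestronglyMeasurable ?_ hm
    have h1 : MapsTo (fun y => y) {y | t < s y} (Ioi 0) := fun y hy => F.pos_of_lt_time ht hy
    have h2 : MapsTo (flow s (-t)) {y | t < s y} (Ioi 0) := fun y hy =>
      F.flow_pos (by have : t < s y := hy; linarith)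
    have hc := (continuous_flow s (-t)).continuousOn (s := {y | t < s y})
    refine RCLike.continuous_ofReal.comp_continuousOn (ContinuousOn.mul ?_ ?_)
    · exact Real.continuous_exp.comp_continuousOn
        ((F.loss_cont.mono h1).sub (F.loss_cont.comp hc h2)).neg
    · exact (F.r_cont.comp hc h2).div (F.r_cont.mono h1) fun y hy => (F.r_pos y (h1 hy)).ne'
  exact hmul.mul (hf.comp_measurable (continuous_flow s (-t)).measurable).aestronglyMeasurable

theorem memLp_transport (F : IsFlow r a s A C) (hα : 0 ≤ α) {t : ℝ} (ht : 0 ≤ t) (f : X₀ 𝕜 α) :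
    MemLp (transport r s A t f) 1 (weight α) := by
  refine ⟨F.aestronglyMeasurable_transport ht (Lp.stronglyMeasurable f), ?_⟩
  rw [eLpNorm_one_eq_lintegral_enorm]
  refine (F.lintegral_weight_transport_le' hα ht f).trans_lt ?_
  rw [← ofReal_norm_eq]
  exact ENNReal.mul_lt_top ENNReal.ofReal_lt_top ENNReal.ofReal_lt_top

theorem transport_add (t : ℝ) (f g : ℝ → 𝕜) :
    transport r s A t (f + g) = transport r s A t f + transport r s A t g := by
  ext y
  simp only [transport, Pi.add_apply]
  split_ifs <;> simp [mul_add]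

theorem transport_smul (t : ℝ) (c : 𝕜) (f : ℝ → 𝕜) :
    transport r s A t (c • f) = c • transport r s A t f := by
  ext y
  simp only [transport, Pi.smul_apply, smul_eq_mul]
  split_ifs
  · ring
  · simp

/-- The bounded operator `U(t)`. -/
def transportOp (F : IsFlow r a s A C) (𝕜 : Type*) [RCLike 𝕜] (hα : 0 ≤ α) (t : ℝ≥0) :
    X₀ 𝕜 α →L[𝕜] X₀ 𝕜 α :=
  LinearMap.mkContinuous
    { toFun := fun f => (F.memLp_transport hα t.coe_nonneg f).toLp _
      map_add' := fun f g => by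
        rw [← MemLp.toLp_add]
        refine MemLp.toLp_congr _ _ ((F.transport_congr t.coe_nonneg (Lp.coeFn_add f g)).trans ?_)
        rw [transport_add]
      map_smul' := fun c f => by
        rw [RingHom.id_apply, ← MemLp.toLp_const_smul]
        refine MemLp.toLp_congr _ _ ((F.transport_congr t.coe_nonneg (Lp.coeFn_smul c f)).trans ?_)
        rw [transport_smul] }
    (Real.exp (α * C * t)) fun f => by
      refine norm_le_of_lintegral_le (by positivity) ?_
      rw [ENNReal.ofReal_mul (Real.exp_pos _).le, ofReal_norm_eq]
      refine le_of_eq_of_le (lintegral_congr_ae ?_)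
        (F.lintegral_weight_transport_le' hα t.coe_nonneg f)
      filter_upwards [(F.memLp_transport hα t.coe_nonneg f).coeFn_toLp] with x hx
      simp only [LinearMap.coe_mk, AddHom.coe_mk, hx]

theorem coeFn_transportOp (F : IsFlow r a s A C) (hα : 0 ≤ α) (t : ℝ≥0) (f : X₀ 𝕜 α) :
    F.transportOp 𝕜 hα t f =ᵐ[weight α] transport r s A t f :=
  (F.memLp_transport hα t.coe_nonneg f).coeFn_toLp

theorem norm_transportOp_le (F : IsFlow r a s A C) (hα : 0 ≤ α) (t : ℝ≥0) :
    ‖F.transportOp 𝕜 hα t‖ ≤ Real.exp (α * C * t) :=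
  LinearMap.mkContinuous_norm_le _ (Real.exp_pos _).le _

theorem transport_zero (F : IsFlow r a s A C) (f : ℝ → 𝕜) {y : ℝ} (hy : 0 < y) :
    transport r s A 0 f y = f y := by
  simp [transport, F.time_pos hy, flow_zero, (F.r_pos y hy).ne']

theorem transport_transport (F : IsFlow r a s A C) {t u : ℝ} (hu : 0 ≤ u)
    (f : ℝ → 𝕜) (y : ℝ) :
    transport r s A t (transport r s A u f) y = transport r s A (t + u) f y := by
  simp only [transport]
  rw [time_flow, flow_flow, ← neg_add]
  by_cases h1 : t + u < s y
  · have hx : 0 < flow s (-t) y := F.flow_pos (by linarith)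
    have hrx := (F.r_pos _ hx).ne'
    rw [if_pos (by linarith), if_pos (by linarith), if_pos h1, ← mul_assoc, ← RCLike.ofReal_mul]
    congr 2
    rw [show -(A y - A (flow s (-(t + u)) y)) = -(A y - A (flow s (-t) y)) +
      -(A (flow s (-t) y) - A (flow s (-(t + u)) y)) by ring, Real.exp_add]
    field_simp
  · rw [if_neg h1]
    split_ifs with h2 h3
    · exact absurd (by linarith) h1
    · simp
    · rfl

theorem tendsto_transport (F : IsFlow r a s A C) {f : ℝ → 𝕜} (hf : Continuous f) {y : ℝ}
    (hy : 0 < y) : Tendsto (fun t => transport r s A t f y) (𝓝 0) (𝓝 (f y)) := by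
  have hx : Tendsto (fun t => flow s (-t) y) (𝓝 0) (𝓝 y) := by
    have := ((continuous_flow_time s y).comp continuous_neg).tendsto 0
    simpa [flow_zero, Function.comp_def] using this
  have hA := (F.loss_cont.continuousAt (Ioi_mem_nhds hy)).tendsto.comp hx
  have hr := (F.r_cont.continuousAt (Ioi_mem_nhds hy)).tendsto.comp hx
  have h1 : Tendsto (fun t => ((Real.exp (-(A y - A (flow s (-t) y))) *
      (r (flow s (-t) y) / r y) : ℝ) : 𝕜) * f (flow s (-t) y)) (𝓝 0)
      (𝓝 (((Real.exp (-(A y - A y)) * (r y / r y) : ℝ) : 𝕜) * f y)) := by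
    refine Tendsto.mul ((RCLike.continuous_ofReal.tendsto _).comp (Tendsto.mul ?_ ?_))
      ((hf.tendsto y).comp hx)
    · exact (Real.continuous_exp.tendsto _).comp (hA.const_sub _).neg
    · exact hr.div_const _
  have e : ((Real.exp (-(A y - A y)) * (r y / r y) : ℝ) : 𝕜) * f y = f y := by
    simp [(F.r_pos y hy).ne']
  rw [e] at h1
  refine h1.congr' ?_
  filter_upwards [Iio_mem_nhds (F.time_pos hy)] with t ht
  simp only [transport]
  rw [if_pos (by exact ht)]

/-- The transport semigroup `U` on the weighted space. -/
def semigroup (F : IsFlow r a s A C) (𝕜 : Type*) [RCLike 𝕜] (hα : 0 ≤ α) :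
    C0Semigroup 𝕜 (X₀ 𝕜 α) :=
  C0Semigroup.ofDense (F.transportOp 𝕜 hα)
    (by
      ext1 f
      refine Lp.ext ((F.coeFn_transportOp hα 0 f).trans ?_)
      filter_upwards [ae_weight_pos α] with y hy
      simpa using F.transport_zero f hy)
    (fun t u => by
      ext1 f
      refine Lp.ext ((F.coeFn_transportOp hα (t + u) f).trans ?_)
      have h1 := F.coeFn_transportOp hα t (F.transportOp 𝕜 hα u f)
      have h2 := F.transport_congr t.coe_nonneg (F.coeFn_transportOp hα u f)
      filter_upwards [h1, h2] with y hy1 hy2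
      rw [ContinuousLinearMap.comp_apply, hy1, hy2,
        F.transport_transport u.coe_nonneg, NNReal.coe_add])
    (α * C) (mul_nonneg hα F.C_pos.le) (F.norm_transportOp_le hα) _ (dense_continuous hα)
    (by
      rintro f ⟨g, hg, hfg⟩
      refine tendsto_of_seq_tendsto fun u hu => ?_
      have hu' : Tendsto (fun n => (u n : ℝ)) atTop (𝓝 0) := by
        simpa [Function.comp_def] using (NNReal.continuous_coe.tendsto 0).comp hu
      refine tendsto_of_ae_tendsto_of_norm_le (c := fun n => Real.exp (α * C * u n)) ?_ ?_
        fun n => (F.transportOp 𝕜 hα (u n)).le_of_opNorm_le (F.norm_transportOp_le hα _) f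
      · have h : ∀ n, F.transportOp 𝕜 hα (u n) f =ᵐ[weight α] transport r s A (u n) g := fun n =>
          (F.coeFn_transportOp hα (u n) f).trans (F.transport_congr (u n).coe_nonneg hfg)
        filter_upwards [ae_all_iff.2 h, hfg, ae_weight_pos α] with y hy hy2 hy0
        rw [hy2]
        exact ((F.tendsto_transport hg hy0).comp hu').congr fun n => (hy n).symm
      · have : Continuous fun x : ℝ => Real.exp (α * C * x) := by fun_prop
        simpa [Function.comp_def] using (this.tendsto 0).comp hu')

theorem semigroup_op (F : IsFlow r a s A C) (hα : 0 ≤ α) (t : ℝ≥0) :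
    (F.semigroup 𝕜 hα).op t = F.transportOp 𝕜 hα t := rfl

theorem isTransported (F : IsFlow r a s A C) (hα : 0 ≤ α) (t : ℝ≥0) (f : X₀ 𝕜 α) :
    IsTransported r a t f ((F.semigroup 𝕜 hα).op t f) := by
  have h := ae_weight_iff.1 (F.coeFn_transportOp hα t f)
  filter_upwards [h, ae_restrict_mem measurableSet_Ioi] with y hy hy0
  have hy0' : 0 < y := hy0
  have hs : ∫ τ in (0 : ℝ)..y, 1 / r τ = s y := by
    rw [F.time_integral 0 y le_rfl hy0'.le, F.time_zero, sub_zero]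
  rw [hs, semigroup_op, hy]
  refine ⟨fun hty => ?_, fun hty => by simp [transport, not_lt.2 hty]⟩
  have hX : 0 < flow s (-(t : ℝ)) y := F.flow_pos (by linarith)
  have hXy : flow s (-(t : ℝ)) y ≤ y := by
    rw [← s.le_iff_le, time_flow]; linarith [t.coe_nonneg]
  refine ⟨flow s (-(t : ℝ)) y, ⟨⟨hX, hXy⟩, ?_⟩, ?_⟩
  · rw [F.time_integral _ y hX.le hXy, time_flow]; ring
  · rw [F.loss_integral _ y hX hXy]
    simp [transport, hty]

end IsFlow

/-! ### Dissipativity of the transport generator -/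

/-- The factor by which mass starting at `x` may have grown at time `h`: the growth bound of the
weight times the surviving fraction. -/
def gain (s : ℝ ≃o ℝ) (A : ℝ → ℝ) (ω h x : ℝ) : ℝ :=
  Real.exp (ω * h) * Real.exp (-(A (flow s h x) - A x))

namespace IsFlow

variable {𝕜 : Type*} [RCLike 𝕜] {r a : ℝ → ℝ} {s : ℝ ≃o ℝ} {A : ℝ → ℝ} {C : ℝ} {α : ℝ}

theorem gain_pos (ω h x : ℝ) : 0 < gain s A ω h x := by
  unfold gain; positivity

theorem gain_le (F : IsFlow r a s A C) (ω : ℝ) {h x : ℝ} (hh : 0 ≤ h) (hx : 0 < x) :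
    gain s A ω h x ≤ Real.exp (ω * h) := by
  refine mul_le_of_le_one_right (Real.exp_pos _).le (Real.exp_le_one_iff.2 ?_)
  linarith [F.loss_flow_nonneg hh hx]

theorem aemeasurable_gain (F : IsFlow r a s A C) (ω : ℝ) {h : ℝ} (hh : 0 ≤ h) :
    AEMeasurable (gain s A ω h) (weight α) := by
  have hc : ContinuousOn (gain s A ω h) (Ioi 0) := by
    refine continuousOn_const.mul (Real.continuous_exp.comp_continuousOn ?_)
    exact ((F.loss_cont.comp (continuous_flow s h).continuousOn
      fun x hx => flow_pos_of_nonneg s hh hx).sub F.loss_cont).neg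
  exact (hc.aemeasurable measurableSet_Ioi).mono_ac (withDensity_absolutelyContinuous _ _)

theorem hasDerivAt_gain (F : IsFlow r a s A C) (ω : ℝ) {x : ℝ} (hx : 0 < x)
    (hA : HasDerivAt A (a x / r x) x) : HasDerivAt (fun h => gain s A ω h x) (ω - a x) 0 := by
  have h1 : HasDerivAt (fun h : ℝ => Real.exp (ω * h)) ω 0 := by
    simpa using ((hasDerivAt_id (0 : ℝ)).const_mul ω).exp
  have hA' : HasDerivAt A (a x / r x) (flow s 0 x) := by rwa [flow_zero]
  have h2 := (((hA'.comp (0 : ℝ) (F.hasDerivAt_flow_time hx)).sub_const (A x)).neg).exp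
  have h3 := h1.mul h2
  refine h3.congr_deriv ?_
  simp [flow_zero, (F.r_pos x hx).ne']
  ring

/-- Comparison of `φ` with the difference quotient of its orbit at time `h = 1 / k`. -/
theorem lintegral_gain_le (F : IsFlow r a s A C) (hα : 0 ≤ α) {lam : ℝ} {h : ℝ≥0} (hh : 0 < h)
    (hlam : (h : ℝ)⁻¹ * Real.exp (α * C * h) ≤ lam + (h : ℝ)⁻¹) (φ : X₀ 𝕜 α) :
    ∫⁻ x, ENNReal.ofReal (lam + (h : ℝ)⁻¹ - (h : ℝ)⁻¹ * gain s A (α * C) h x) * ‖φ x‖ₑ ∂(weight α)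
      ≤ ENNReal.ofReal ‖(lam : 𝕜) • φ - (F.semigroup 𝕜 hα).quotient φ h‖ := by
  have hk : (0 : ℝ) < (h : ℝ)⁻¹ := by
    have : (0 : ℝ) < h := by exact_mod_cast hh
    positivity
  set k : ℝ := (h : ℝ)⁻¹ with hkdef
  set ψ : X₀ 𝕜 α := (lam : 𝕜) • φ - (F.semigroup 𝕜 hα).quotient φ h with hψ
  have hpt : ∀ᵐ x ∂(weight α), ENNReal.ofReal (lam + k) * ‖φ x‖ₑ ≤
      ‖ψ x‖ₑ + ENNReal.ofReal k * ‖transport r s A h φ x‖ₑ := by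
    have e1 := Lp.coeFn_sub ((lam : 𝕜) • φ) ((F.semigroup 𝕜 hα).quotient φ h)
    have e2 := Lp.coeFn_smul (lam : 𝕜) φ
    have e3 := Lp.coeFn_smul (k : 𝕜) (F.transportOp 𝕜 hα h φ - φ)
    have e4 := Lp.coeFn_sub (F.transportOp 𝕜 hα h φ) φ
    filter_upwards [e1, e2, e3, e4, F.coeFn_transportOp hα h φ] with x h1 h2 h3 h4 h5
    have hlk : 0 ≤ lam + k := (by positivity : (0 : ℝ) ≤ k * Real.exp (α * C * h)).trans hlam
    have e : ((lam + k : ℝ) : 𝕜) * φ x = ψ x + (k : 𝕜) * transport r s A h φ x := by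
      rw [hψ, h1, Pi.sub_apply, h2, C0Semigroup.quotient, semigroup_op, h3, Pi.smul_apply,
        Pi.smul_apply, h4, Pi.sub_apply, h5, smul_eq_mul, smul_eq_mul]
      push_cast
      ring
    have n1 : ‖((lam + k : ℝ) : 𝕜)‖ₑ = ENNReal.ofReal (lam + k) := by
      rw [← ofReal_norm, RCLike.norm_ofReal, abs_of_nonneg hlk]
    have n2 : ‖(k : 𝕜)‖ₑ = ENNReal.ofReal k := by
      rw [← ofReal_norm, RCLike.norm_ofReal, abs_of_nonneg hk.le]
    rw [← n1, ← n2, ← enorm_mul, ← enorm_mul, e]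
    exact enorm_add_le _ _
  have hmψ : AEMeasurable (fun x => ‖ψ x‖ₑ) (weight α) := (Lp.aestronglyMeasurable ψ).enorm
  have hmφ : AEMeasurable (fun x => ‖φ x‖ₑ) (weight α) := (Lp.aestronglyMeasurable φ).enorm
  have hint := lintegral_mono_ae hpt
  rw [lintegral_add_left' hmψ, ← ofReal_norm_eq,
    lintegral_const_mul' (ENNReal.ofReal k) _ ENNReal.ofReal_ne_top] at hint
  have hint2 : ∫⁻ x, ENNReal.ofReal (lam + k) * ‖φ x‖ₑ ∂(weight α) ≤ ENNReal.ofReal ‖ψ‖ +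
      ∫⁻ x, ENNReal.ofReal (k * gain s A (α * C) h x) * ‖φ x‖ₑ ∂(weight α) := by
    refine hint.trans ?_
    gcongr
    refine (mul_le_mul_right (F.lintegral_weight_transport_le hα h.coe_nonneg φ) _).trans_eq ?_
    rw [← lintegral_const_mul' _ _ ENNReal.ofReal_ne_top]
    refine lintegral_congr fun x => ?_
    rw [← mul_assoc, ← ENNReal.ofReal_mul hk.le]
    rfl
  have hsplit : ∫⁻ x, ENNReal.ofReal (lam + k) * ‖φ x‖ₑ ∂(weight α) =
      ∫⁻ x, ENNReal.ofReal (lam + k - k * gain s A (α * C) h x) * ‖φ x‖ₑ ∂(weight α) +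
      ∫⁻ x, ENNReal.ofReal (k * gain s A (α * C) h x) * ‖φ x‖ₑ ∂(weight α) := by
    rw [← lintegral_add_right']
    · refine lintegral_congr_ae ?_
      filter_upwards [ae_weight_pos α] with x hx
      have hg := mul_le_mul_of_nonneg_left (F.gain_le (α * C) h.coe_nonneg hx) hk.le
      rw [← add_mul, ← ENNReal.ofReal_add (by linarith) (mul_nonneg hk.le (gain_pos _ _ _).le),
        sub_add_cancel]
    · exact (((F.aemeasurable_gain (α * C) h.coe_nonneg).const_mul k).ennreal_ofReal).mul hmφ
  have hfin : ∫⁻ x, ENNReal.ofReal (k * gain s A (α * C) h x) * ‖φ x‖ₑ ∂(weight α) ≠ ∞ := by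
    refine ne_top_of_le_ne_top (b := ENNReal.ofReal (lam + k) * ENNReal.ofReal ‖φ‖)
      (ENNReal.mul_ne_top ENNReal.ofReal_ne_top ENNReal.ofReal_ne_top) ?_
    rw [ofReal_norm_eq, ← lintegral_const_mul' _ _ ENNReal.ofReal_ne_top, hsplit]
    exact self_le_add_left _ _
  rw [hsplit] at hint2
  exact ENNReal.le_of_add_le_add_right hfin hint2

/-- The key estimate: for `λ > α C`, the operator `λ - T` controls both `φ` and the absorption
`a φ`. It follows from the contraction estimate for the difference quotients by Fatou's lemma, since
the gain at time `h` is `1 + h (α C - a(x)) + o(h)` at almost every `x`. -/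
theorem lintegral_absorption_le (F : IsFlow r a s A C) (hα : 0 ≤ α) {lam : ℝ} (hlam : α * C < lam)
    {φ ψ : X₀ 𝕜 α} (hφ : (F.semigroup 𝕜 hα).HasGenerator φ ψ) :
    ∫⁻ x, ENNReal.ofReal (lam - α * C + a x) * ‖φ x‖ₑ ∂(weight α) ≤
      ENNReal.ofReal ‖(lam : 𝕜) • φ - ψ‖ := by
  set h : ℕ → ℝ≥0 := fun n => ((n : ℝ≥0) + 1)⁻¹ with hh
  have hpos : ∀ n, 0 < h n := fun n => by positivity
  have h0 : Tendsto h atTop (𝓝[>] 0) := by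
    refine tendsto_nhdsWithin_iff.2 ⟨?_, Eventually.of_forall hpos⟩
    rw [← NNReal.tendsto_coe]
    have := tendsto_one_div_add_atTop_nhds_zero_nat (𝕜 := ℝ)
    simpa [hh] using this
  have h0' : Tendsto (fun n => (h n : ℝ)) atTop (𝓝[≠] 0) := by
    refine tendsto_nhdsWithin_iff.2 ⟨?_, Eventually.of_forall fun n => ?_⟩
    · exact NNReal.tendsto_coe.2 (h0.mono_right nhdsWithin_le_nhds)
    · have : (0 : ℝ) < h n := by exact_mod_cast hpos n
      exact this.ne'
  have hev : ∀ᶠ n in atTop, (h n : ℝ)⁻¹ * Real.exp (α * C * h n) ≤ lam + (h n : ℝ)⁻¹ := by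
    have hd : HasDerivAt (fun h : ℝ => Real.exp (α * C * h)) (α * C) 0 := by
      simpa using ((hasDerivAt_id (0 : ℝ)).const_mul (α * C)).exp
    have := (hasDerivAt_iff_tendsto_slope.1 hd).comp h0'
    filter_upwards [this.eventually_lt_const hlam] with n hn
    simp only [Function.comp_apply, slope, vsub_eq_sub, sub_zero, mul_zero, Real.exp_zero,
      smul_eq_mul] at hn
    linarith
  have hT : Tendsto (fun n => ENNReal.ofReal
      ‖(lam : 𝕜) • φ - (F.semigroup 𝕜 hα).quotient φ (h n)‖) atTop
      (𝓝 (ENNReal.ofReal ‖(lam : 𝕜) • φ - ψ‖)) :=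
    (ENNReal.continuous_ofReal.tendsto _).comp ((hφ.comp h0).const_sub _).norm
  have hmφ : AEMeasurable (fun x => ‖φ x‖ₑ) (weight α) := (Lp.aestronglyMeasurable φ).enorm
  have hpt : ∀ᵐ x ∂(weight α), Tendsto (fun n => ENNReal.ofReal
      (lam + (h n : ℝ)⁻¹ - (h n : ℝ)⁻¹ * gain s A (α * C) (h n) x) * ‖φ x‖ₑ) atTop
      (𝓝 (ENNReal.ofReal (lam - α * C + a x) * ‖φ x‖ₑ)) := by
    filter_upwards [ae_weight_iff.2 F.loss_deriv, ae_weight_pos α] with x hx hx0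
    refine ENNReal.Tendsto.mul_const ((ENNReal.continuous_ofReal.tendsto _).comp ?_)
      (Or.inr enorm_ne_top)
    have := ((hasDerivAt_iff_tendsto_slope.1 (F.hasDerivAt_gain (α * C) hx0 hx)).comp
      h0').const_sub lam
    rw [show lam - (α * C - a x) = lam - α * C + a x by ring] at this
    refine this.congr fun n => ?_
    have hg0 : gain s A (α * C) 0 x = 1 := by simp [gain, flow_zero]
    simp only [Function.comp_apply, slope, vsub_eq_sub, sub_zero, hg0, smul_eq_mul]
    ring
  calc _ = ∫⁻ x, liminf (fun n => ENNReal.ofReal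
        (lam + (h n : ℝ)⁻¹ - (h n : ℝ)⁻¹ * gain s A (α * C) (h n) x) * ‖φ x‖ₑ) atTop ∂(weight α) := by
        refine lintegral_congr_ae ?_
        filter_upwards [hpt] with x hx
        exact hx.liminf_eq.symm
    _ ≤ liminf (fun n => ∫⁻ x, ENNReal.ofReal
        (lam + (h n : ℝ)⁻¹ - (h n : ℝ)⁻¹ * gain s A (α * C) (h n) x) * ‖φ x‖ₑ ∂(weight α)) atTop := by
        refine lintegral_liminf_le' fun n => AEMeasurable.mul ?_ hmφ
        exact (((F.aemeasurable_gain (α * C) (h n).coe_nonneg).const_mul _).const_sub _).ennreal_ofReal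
    _ ≤ liminf (fun n => ENNReal.ofReal
        ‖(lam : 𝕜) • φ - (F.semigroup 𝕜 hα).quotient φ (h n)‖) atTop := by
        refine liminf_le_liminf ?_
        filter_upwards [hev] with n hn
        exact F.lintegral_gain_le hα (hpos n) hn φ
    _ = _ := hT.liminf_eq

end IsFlow

/-! ### Domination and positivity -/

section Domination

variable {𝕜 : Type*} [RCLike 𝕜] {α : ℝ}

/-- `g` dominates `f`: `|f| ≤ Re g` almost everywhere. Nonnegativity of `g` is domination of `g` by
itself, and the pairs `(f, g)` form a closed convex cone, also over the complex numbers. -/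
def IsDominated (f g : X₀ 𝕜 α) : Prop := ∀ᵐ x ∂(weight α), ‖f x‖ ≤ RCLike.re (g x)

theorem isNonneg_iff_isDominated {g : X₀ 𝕜 α} : IsNonneg g ↔ IsDominated g g := by
  refine eventually_congr (ae_of_all _ fun x => ?_)
  constructor
  · intro h
    rw [h]; simp
  · intro h
    exact RCLike.norm_le_re_iff_eq_norm.1 h

theorem IsDominated.norm_le {f g : X₀ 𝕜 α} (h : IsDominated f g) : ‖f‖ ≤ ‖g‖ := by
  refine Lp.norm_le_norm_of_ae_le ?_
  filter_upwards [h] with x hx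
  exact hx.trans (RCLike.re_le_norm _)

theorem exists_isDominated_norm_eq (f : X₀ 𝕜 α) : ∃ g : X₀ 𝕜 α, IsDominated f g ∧ ‖g‖ = ‖f‖ := by
  have hm : MemLp (fun x => ((‖f x‖ : ℝ) : 𝕜)) 1 (weight α) := (Lp.memLp f).norm.ofReal
  refine ⟨hm.toLp _, ?_, ?_⟩
  · filter_upwards [hm.coeFn_toLp] with x hx
    rw [hx, RCLike.ofReal_re]
  · refine le_antisymm (Lp.norm_le_norm_of_ae_le ?_) (Lp.norm_le_norm_of_ae_le ?_) <;>
    · filter_upwards [hm.coeFn_toLp] with x hx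
      simp [hx]

theorem IsDominated.add {f g f' g' : X₀ 𝕜 α} (h : IsDominated f g) (h' : IsDominated f' g') :
    IsDominated (f + f') (g + g') := by
  filter_upwards [h, h', Lp.coeFn_add f f', Lp.coeFn_add g g'] with x h1 h2 h3 h4
  rw [h3, h4, Pi.add_apply, Pi.add_apply, map_add]
  exact (norm_add_le _ _).trans (add_le_add h1 h2)

theorem IsDominated.zero : IsDominated (0 : X₀ 𝕜 α) 0 := by
  filter_upwards [Lp.coeFn_zero 𝕜 1 (weight α)] with x hx
  rw [hx]; simp

theorem IsDominated.smul_of_le {f g : X₀ 𝕜 α} (h : IsDominated f g) {c d : ℝ} (hc : 0 ≤ c)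
    (hcd : c ≤ d) : IsDominated ((c : 𝕜) • f) ((d : 𝕜) • g) := by
  filter_upwards [h, Lp.coeFn_smul (c : 𝕜) f, Lp.coeFn_smul (d : 𝕜) g] with x h1 h2 h3
  rw [h2, h3, Pi.smul_apply, Pi.smul_apply, smul_eq_mul, smul_eq_mul, norm_mul, RCLike.norm_ofReal,
    abs_of_nonneg hc, RCLike.re_ofReal_mul]
  exact mul_le_mul hcd h1 (norm_nonneg _) (hc.trans hcd)

theorem IsDominated.smul {f g : X₀ 𝕜 α} (h : IsDominated f g) {c : ℝ} (hc : 0 ≤ c) :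
    IsDominated ((c : 𝕜) • f) ((c : 𝕜) • g) := h.smul_of_le hc le_rfl

theorem IsDominated.of_tendsto {f g : ℕ → X₀ 𝕜 α} {f' g' : X₀ 𝕜 α}
    (h : ∀ n, IsDominated (f n) (g n)) (hf : Tendsto f atTop (𝓝 f')) (hg : Tendsto g atTop (𝓝 g')) :
    IsDominated f' g' := by
  obtain ⟨u, hu, hfu⟩ := (tendstoInMeasure_of_tendsto_Lp hf).exists_seq_tendsto_ae
  obtain ⟨v, hv, hgv⟩ :=
    (tendstoInMeasure_of_tendsto_Lp (hg.comp hu.tendsto_atTop)).exists_seq_tendsto_ae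
  filter_upwards [hfu, hgv, ae_all_iff.2 h] with x h1 h2 h3
  exact le_of_tendsto_of_tendsto' (h1.comp hv.tendsto_atTop).norm
    ((RCLike.continuous_re.tendsto _).comp h2) fun n => h3 _

variable (𝕜 α) in
/-- The closed convex cone of the pairs `(f, g)` such that `g` dominates `f`. -/
def dominationCone : ProperCone ℝ (X₀ 𝕜 α × X₀ 𝕜 α) where
  carrier := {p | IsDominated p.1 p.2}
  add_mem' := fun h h' => IsDominated.add h h'
  zero_mem' := IsDominated.zero
  smul_mem' := fun c p h => by
    have := IsDominated.smul h c.2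
    rw [← RCLike.real_smul_eq_coe_smul, ← RCLike.real_smul_eq_coe_smul] at this
    exact this
  isClosed' := by
    refine IsSeqClosed.isClosed fun p q hp hpq => ?_
    exact IsDominated.of_tendsto hp ((continuous_fst.tendsto q).comp hpq)
      ((continuous_snd.tendsto q).comp hpq)

/-- Integrals of functions with values in a closed convex cone lie in the cone. -/
theorem integral_mem_properCone {X G : Type*} [MeasurableSpace X] {μ : Measure X}
    [NormedAddCommGroup G] [NormedSpace ℝ G] [CompleteSpace G] (K : ProperCone ℝ G) {F : X → G}
    (hF : Integrable F μ) (h : ∀ᵐ t ∂μ, F t ∈ K) : ∫ t, F t ∂μ ∈ K := by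
  by_contra hnot
  obtain ⟨l, hl, hl0⟩ := K.hyperplane_separation_point hnot
  rw [← l.integral_comp_comm hF] at hl0
  exact absurd (integral_nonneg_of_ae (h.mono fun t ht => hl _ ht)) (not_le.2 hl0)

/-- Operators preserving domination, that is, positive operators. -/
def PreservesDomination (L : X₀ 𝕜 α →L[𝕜] X₀ 𝕜 α) : Prop :=
  ∀ f g, IsDominated f g → IsDominated (L f) (L g)

namespace PreservesDomination

theorem one : PreservesDomination (1 : X₀ 𝕜 α →L[𝕜] X₀ 𝕜 α) := fun _ _ h => h

theorem zero : PreservesDomination (0 : X₀ 𝕜 α →L[𝕜] X₀ 𝕜 α) := fun _ _ _ => IsDominated.zero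

theorem add {L M : X₀ 𝕜 α →L[𝕜] X₀ 𝕜 α} (hL : PreservesDomination L) (hM : PreservesDomination M) :
    PreservesDomination (L + M) := fun f g h => (hL f g h).add (hM f g h)

theorem mul {L M : X₀ 𝕜 α →L[𝕜] X₀ 𝕜 α} (hL : PreservesDomination L) (hM : PreservesDomination M) :
    PreservesDomination (L * M) := fun f g h => hL _ _ (hM f g h)

theorem smul {L : X₀ 𝕜 α →L[𝕜] X₀ 𝕜 α} (hL : PreservesDomination L) {c : ℝ} (hc : 0 ≤ c) :
    PreservesDomination ((c : 𝕜) • L) := fun f g h => (hL f g h).smul hc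

theorem pow {L : X₀ 𝕜 α →L[𝕜] X₀ 𝕜 α} (hL : PreservesDomination L) (n : ℕ) :
    PreservesDomination (L ^ n) := by
  induction n with
  | zero => simpa using one
  | succ n ih => rw [pow_succ]; exact ih.mul hL

theorem sum {ι : Type*} {L : ι → X₀ 𝕜 α →L[𝕜] X₀ 𝕜 α} (s : Finset ι)
    (hL : ∀ i, PreservesDomination (L i)) : PreservesDomination (∑ i ∈ s, L i) := by
  classical
  induction s using Finset.induction_on with
  | empty => simpa using zero
  | insert i s hi ih => rw [Finset.sum_insert hi]; exact (hL i).add ih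

theorem of_tendsto {L : ℕ → X₀ 𝕜 α →L[𝕜] X₀ 𝕜 α} {L' : X₀ 𝕜 α →L[𝕜] X₀ 𝕜 α}
    (hL : ∀ n, PreservesDomination (L n)) (h : ∀ f, Tendsto (fun n => L n f) atTop (𝓝 (L' f))) :
    PreservesDomination L' := fun f g hfg =>
  IsDominated.of_tendsto (fun n => hL n f g hfg) (h f) (h g)

theorem expOp {Q : X₀ 𝕜 α →L[𝕜] X₀ 𝕜 α} (hQ : PreservesDomination Q) (c : ℝ) {t : ℝ} (ht : 0 ≤ t) :
    PreservesDomination (expOp Q c t) := by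
  refine PreservesDomination.smul ?_ (Real.exp_pos _).le
  refine of_tendsto (L := fun n => ∑ i ∈ Finset.range n,
    (((i.factorial : ℝ)⁻¹ * t ^ i : ℝ) : 𝕜) • Q ^ i) (fun n => sum _ fun i => ?_) fun f => ?_
  · exact (hQ.pow i).smul (by positivity)
  · refine (hasSum_exp_apply Q t f).tendsto_sum_nat.congr fun n => ?_
    rw [sum_apply]
    refine Finset.sum_congr rfl fun i _ => ?_
    rw [smul_apply]
    push_cast
    rfl

end PreservesDomination

end Domination

/-! ### Bounds for the fragmentation operator -/

section FragBound

variable {𝕜 : Type*} [RCLike 𝕜] {α : ℝ} {a : ℝ → ℝ} {b : ℝ → ℝ → ℝ}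

/-- The standing assumptions on the fragmentation rate and kernel. -/
structure IsFragKernel (a : ℝ → ℝ) (b : ℝ → ℝ → ℝ) : Prop where
  a_meas : AEMeasurable a (volume.restrict (Ioi (0 : ℝ)))
  a_nonneg : ∀ y, 0 < y → 0 ≤ a y
  b_meas : AEMeasurable (fun p : ℝ × ℝ => b p.1 p.2)
    (volume.restrict (Ioi (0 : ℝ) ×ˢ Ioi (0 : ℝ)))
  b_nonneg : ∀ x y, 0 < x → 0 < y → 0 ≤ b x y
  b_zero : ∀ x y, 0 < y → y ≤ x → b x y = 0

instance : SFinite (weight α) := by unfold weight; infer_instance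

theorem weight_absolutelyContinuous : weight α ≪ volume.restrict (Ioi (0 : ℝ)) :=
  withDensity_absolutelyContinuous _ _

namespace IsFragKernel

theorem aestronglyMeasurable_fragIntegrand (K : IsFragKernel a b) (φ : X₀ 𝕜 α) :
    AEStronglyMeasurable (Function.uncurry (fragIntegrand a b φ))
      ((weight α).prod (volume.restrict (Ioi (0 : ℝ)))) := by
  have hac : (weight α).prod (volume.restrict (Ioi (0 : ℝ))) ≪
      (volume.restrict (Ioi (0 : ℝ))).prod (volume.restrict (Ioi (0 : ℝ))) :=
    weight_absolutelyContinuous.prod Measure.AbsolutelyContinuous.rfl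
  have hb : AEMeasurable (fun p : ℝ × ℝ => b p.1 p.2)
      ((weight α).prod (volume.restrict (Ioi (0 : ℝ)))) := by
    refine AEMeasurable.mono_ac ?_ hac
    rw [Measure.prod_restrict]
    exact K.b_meas
  have ha : AEMeasurable (fun p : ℝ × ℝ => a p.2)
      ((weight α).prod (volume.restrict (Ioi (0 : ℝ)))) := K.a_meas.comp_snd
  have hφ : AEStronglyMeasurable (fun p : ℝ × ℝ => φ p.2)
      ((weight α).prod (volume.restrict (Ioi (0 : ℝ)))) :=
    ((Lp.stronglyMeasurable φ).comp_measurable measurable_snd).aestronglyMeasurable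
  exact (RCLike.continuous_ofReal.comp_aestronglyMeasurable (ha.mul hb).aestronglyMeasurable).mul hφ

/-- The total weight of the fragments of a particle of size `y`. -/
theorem lintegral_kernel (K : IsFragKernel a b) {y : ℝ} (hy : 0 < y) :
    ∫⁻ x, ENNReal.ofReal (b x y) ∂(weight α) =
      momentRatio α b y * ENNReal.ofReal ((1 + y) ^ α) := by
  have hpos : 0 < (1 + y) ^ α := Real.rpow_pos_of_pos (by linarith) _
  rw [momentRatio, ENNReal.div_mul_cancel (by simpa using hpos) ENNReal.ofReal_ne_top,
    lintegral_weight]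
  have e : ∀ x ∈ Ioi (0 : ℝ), ENNReal.ofReal ((1 + x) ^ α) * ENNReal.ofReal (b x y) =
      (Iio y).indicator (fun x => ENNReal.ofReal ((1 + x) ^ α * b x y)) x := by
    intro x hx
    have hx0 : 0 < x := hx
    by_cases h : x < y
    · rw [indicator_of_mem (show x ∈ Iio y from h), ENNReal.ofReal_mul (Real.rpow_nonneg (by linarith) _)]
    · rw [indicator_of_notMem (show x ∉ Iio y from h), K.b_zero x y hy (not_lt.1 h)]
      simp
  rw [setLIntegral_congr_fun measurableSet_Ioi e, setLIntegral_indicator measurableSet_Iio,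
    inter_comm, Ioi_inter_Iio]

theorem enorm_fragIntegrand (K : IsFragKernel a b) (φ : ℝ → 𝕜) {x y : ℝ} (hx : 0 < x) (hy : 0 < y) :
    ‖fragIntegrand a b φ x y‖ₑ = ENNReal.ofReal (a y) * ‖φ y‖ₑ * ENNReal.ofReal (b x y) := by
  rw [fragIntegrand, enorm_mul, ← ofReal_norm (((a y * b x y : ℝ) : 𝕜)), RCLike.norm_ofReal,
    abs_of_nonneg (mul_nonneg (K.a_nonneg y hy) (K.b_nonneg x y hx hy)),
    ENNReal.ofReal_mul (K.a_nonneg y hy)]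
  ring

/-- If the moment ratio is at most `M` everywhere, and at most `θ` where `a ≥ c`, then the
fragmentation gain is at most `θ a + c M` times the density, in weighted mean. -/
theorem lintegral_fragIntegrand_le (K : IsFragKernel a b) {θ M c : ℝ≥0}
    (hM : ∀ y, 0 < y → momentRatio α b y ≤ M)
    (hθ : ∀ y, 0 < y → (c : ℝ) ≤ a y → momentRatio α b y ≤ θ) (φ : X₀ 𝕜 α) :
    ∫⁻ x, (∫⁻ y in Ioi (0 : ℝ), ‖fragIntegrand a b φ x y‖ₑ) ∂(weight α) ≤
      θ * (∫⁻ y, ENNReal.ofReal (a y) * ‖φ y‖ₑ ∂(weight α)) + c * M * ENNReal.ofReal ‖φ‖ := by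
  rw [lintegral_lintegral_swap (K.aestronglyMeasurable_fragIntegrand φ).enorm]
  have h1 : ∀ y ∈ Ioi (0 : ℝ), ∫⁻ x, ‖fragIntegrand a b φ x y‖ₑ ∂(weight α) ≤
      ENNReal.ofReal ((1 + y) ^ α) * (θ * (ENNReal.ofReal (a y) * ‖φ y‖ₑ) + c * M * ‖φ y‖ₑ) := by
    intro y hy
    have hy0 : 0 < y := hy
    have e : ∫⁻ x, ‖fragIntegrand a b φ x y‖ₑ ∂(weight α) =
        ENNReal.ofReal (a y) * ‖φ y‖ₑ * (momentRatio α b y * ENNReal.ofReal ((1 + y) ^ α)) := by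
      rw [← K.lintegral_kernel hy0,
        ← lintegral_const_mul' _ _ (ENNReal.mul_ne_top ENNReal.ofReal_ne_top enorm_ne_top)]
      refine lintegral_congr_ae ?_
      filter_upwards [ae_weight_pos α] with x hx
      exact K.enorm_fragIntegrand φ hx hy0
    have h2 : ENNReal.ofReal (a y) * momentRatio α b y ≤ θ * ENNReal.ofReal (a y) + c * M := by
      by_cases hc : (c : ℝ) ≤ a y
      · refine le_trans ?_ le_self_add
        rw [mul_comm]
        gcongr
        exact hθ y hy0 hc
      · refine le_trans ?_ (le_add_self)
        have hac : ENNReal.ofReal (a y) ≤ c := by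
          rw [← ENNReal.ofReal_coe_nnreal]
          exact ENNReal.ofReal_le_ofReal (not_le.1 hc).le
        exact mul_le_mul' hac (hM y hy0)
    calc _ = ENNReal.ofReal ((1 + y) ^ α) * ‖φ y‖ₑ *
          (ENNReal.ofReal (a y) * momentRatio α b y) := by rw [e]; ring
      _ ≤ ENNReal.ofReal ((1 + y) ^ α) * ‖φ y‖ₑ * (θ * ENNReal.ofReal (a y) + c * M) := by gcongr
      _ = _ := by ring
  refine (setLIntegral_mono' measurableSet_Ioi h1).trans_eq ?_
  rw [← lintegral_weight fun y => (θ * (ENNReal.ofReal (a y) * ‖φ y‖ₑ) + c * M * ‖φ y‖ₑ),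
    lintegral_add_left', lintegral_const_mul' _ _ ENNReal.coe_ne_top,
    lintegral_const_mul' _ _ (ENNReal.mul_ne_top ENNReal.coe_ne_top ENNReal.coe_ne_top),
    ofReal_norm_eq]
  exact ((K.a_meas.mono_ac weight_absolutelyContinuous).ennreal_ofReal.mul
    (Lp.aestronglyMeasurable φ).enorm).const_mul _

theorem fragIntegral_eq (K : IsFragKernel a b) (φ : ℝ → 𝕜) {x : ℝ} (hx : 0 < x) :
    fragIntegral a b φ x = ∫ y in Ioi (0 : ℝ), fragIntegrand a b φ x y := by
  refine (setIntegral_eq_of_subset_of_forall_sdiff_eq_zero measurableSet_Ioi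
    (Ioi_subset_Ioi hx.le) fun y hy => ?_).symm
  have h1 : 0 < y := hy.1
  have h2 : y ≤ x := not_lt.1 hy.2
  simp [fragIntegrand, K.b_zero x y h1 h2]

theorem inFragDomain (K : IsFragKernel a b) {M : ℝ≥0}
    (hM : ∀ y, 0 < y → momentRatio α b y ≤ M) {φ : X₀ 𝕜 α}
    (hfin : ∫⁻ y, ENNReal.ofReal (a y) * ‖φ y‖ₑ ∂(weight α) ≠ ∞) : InFragDomain a b α φ := by
  have hle := K.lintegral_fragIntegrand_le (θ := M) (c := 0) hM (fun y hy _ => hM y hy) φ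
  have hint : Integrable (Function.uncurry (fragIntegrand a b φ))
      ((weight α).prod (volume.restrict (Ioi (0 : ℝ)))) := by
    refine ⟨K.aestronglyMeasurable_fragIntegrand φ, ?_⟩
    rw [HasFiniteIntegral, lintegral_prod _ (K.aestronglyMeasurable_fragIntegrand φ).enorm]
    refine hle.trans_lt ?_
    simpa using ENNReal.mul_lt_top ENNReal.coe_lt_top hfin.lt_top
  constructor
  · filter_upwards [hint.prod_right_ae, ae_weight_pos α] with x hx hx0
    exact IntegrableOn.mono_set hx (Ioi_subset_Ioi hx0.le)
  · rw [memLp_one_iff_integrable]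
    refine hint.integral_prod_left.congr ?_
    filter_upwards [ae_weight_pos α] with x hx
    exact (K.fragIntegral_eq φ hx).symm

theorem lintegral_fragIntegral_le (K : IsFragKernel a b) (φ : ℝ → 𝕜) :
    ∫⁻ x, ‖fragIntegral a b φ x‖ₑ ∂(weight α) ≤
      ∫⁻ x, (∫⁻ y in Ioi (0 : ℝ), ‖fragIntegrand a b φ x y‖ₑ) ∂(weight α) := by
  refine lintegral_mono_ae ?_
  filter_upwards [ae_weight_pos α] with x hx
  rw [K.fragIntegral_eq φ hx]
  exact enorm_integral_le_lintegral_enorm _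

theorem coeFn_fragmentation (φ : (fragmentation 𝕜 α a b).domain) :
    fragmentation 𝕜 α a b φ =ᵐ[weight α] fragIntegral a b (φ : X₀ 𝕜 α) :=
  MemLp.coeFn_toLp (show InFragDomain a b α (φ : X₀ 𝕜 α) from φ.2).2

theorem ofReal_norm_fragmentation_le (K : IsFragKernel a b) {θ M c : ℝ≥0}
    (hM : ∀ y, 0 < y → momentRatio α b y ≤ M)
    (hθ : ∀ y, 0 < y → (c : ℝ) ≤ a y → momentRatio α b y ≤ θ)
    (φ : (fragmentation 𝕜 α a b).domain) :
    ENNReal.ofReal ‖fragmentation 𝕜 α a b φ‖ ≤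
      θ * (∫⁻ y, ENNReal.ofReal (a y) * ‖(φ : X₀ 𝕜 α) y‖ₑ ∂(weight α)) +
        c * M * ENNReal.ofReal ‖(φ : X₀ 𝕜 α)‖ := by
  have h1 := K.lintegral_fragIntegrand_le hM hθ (φ : X₀ 𝕜 α)
  have h2 := K.lintegral_fragIntegral_le (α := α) (φ : X₀ 𝕜 α)
  have h3 : ∫⁻ x, ‖fragmentation 𝕜 α a b φ x‖ₑ ∂(weight α) =
      ∫⁻ x, ‖fragIntegral a b (φ : X₀ 𝕜 α) x‖ₑ ∂(weight α) := by
    refine lintegral_congr_ae ?_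
    filter_upwards [coeFn_fragmentation φ] with x hx
    rw [hx]
  rw [ofReal_norm_eq, h3]
  exact h2.trans h1

/-- Positivity of the fragmentation operator. -/
theorem isDominated_fragmentation (K : IsFragKernel a b) {φ ψ : (fragmentation 𝕜 α a b).domain}
    (h : IsDominated (φ : X₀ 𝕜 α) ψ) :
    IsDominated (fragmentation 𝕜 α a b φ) (fragmentation 𝕜 α a b ψ) := by
  have hφ : InFragDomain a b α (φ : X₀ 𝕜 α) := φ.2
  have hψ : InFragDomain a b α (ψ : X₀ 𝕜 α) := ψ.2
  filter_upwards [coeFn_fragmentation φ, coeFn_fragmentation ψ, hφ.1, hψ.1, ae_weight_pos α]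
    with x h1 h2 h3 h4 hx
  rw [h1, h2, fragIntegral, fragIntegral]
  refine (norm_integral_le_integral_norm _).trans ?_
  rw [← RCLike.reCLM_apply, ← ContinuousLinearMap.integral_comp_comm _ h4]
  refine integral_mono_ae h3.norm (RCLike.reCLM.integrable_comp h4) ?_
  have hdom := ae_restrict_of_ae_restrict_of_subset (Ioi_subset_Ioi hx.le) (ae_weight_iff.1 h)
  filter_upwards [hdom, ae_restrict_mem measurableSet_Ioi] with y hy hyx
  have hy0 : 0 < y := hx.trans hyx
  have hab := mul_nonneg (K.a_nonneg y hy0) (K.b_nonneg x y hx hy0)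
  simp only [fragIntegrand]
  rw [norm_mul, RCLike.norm_ofReal, abs_of_nonneg hab, RCLike.reCLM_apply, RCLike.re_ofReal_mul]
  gcongr

end IsFragKernel

end FragBound

/-! ### The perturbed generator -/

section Perturbation

variable {𝕜 : Type*} [RCLike 𝕜] {α : ℝ} {r a : ℝ → ℝ} {b : ℝ → ℝ → ℝ} {s : ℝ ≃o ℝ} {A : ℝ → ℝ}
  {C : ℝ}

/-- The absorption `∫ a |φ| (1 + x)^α dx`, with junk value `0` if the integral diverges. -/
def absorption (a : ℝ → ℝ) (φ : X₀ 𝕜 α) : ℝ :=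
  (∫⁻ y, ENNReal.ofReal (a y) * ‖φ y‖ₑ ∂(weight α)).toReal

theorem absorption_nonneg (a : ℝ → ℝ) (φ : X₀ 𝕜 α) : 0 ≤ absorption a φ := ENNReal.toReal_nonneg

theorem IsFlow.absorption_bound (F : IsFlow r a s A C) (hα : 0 ≤ α) {lam : ℝ}
    (hlam : α * C < lam) {φ ψ : X₀ 𝕜 α} (hφ : (F.semigroup 𝕜 hα).HasGenerator φ ψ) :
    ∫⁻ y, ENNReal.ofReal (a y) * ‖φ y‖ₑ ∂(weight α) ≠ ∞ ∧
      (lam - α * C) * ‖φ‖ + absorption a φ ≤ ‖(lam : 𝕜) • φ - ψ‖ := by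
  have h := F.lintegral_absorption_le hα hlam hφ
  have e : ∫⁻ x, ENNReal.ofReal (lam - α * C + a x) * ‖φ x‖ₑ ∂(weight α) =
      ENNReal.ofReal ((lam - α * C) * ‖φ‖) +
        ∫⁻ y, ENNReal.ofReal (a y) * ‖φ y‖ₑ ∂(weight α) := by
    rw [ENNReal.ofReal_mul (by linarith), ofReal_norm_eq,
      ← lintegral_const_mul' _ _ ENNReal.ofReal_ne_top, ← lintegral_add_left']
    · refine lintegral_congr_ae ?_
      filter_upwards [ae_weight_pos α] with x hx
      rw [ENNReal.ofReal_add (by linarith) (F.a_nonneg x hx), add_mul]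
    · exact (Lp.aestronglyMeasurable φ).enorm.const_mul _
  rw [e] at h
  have hfin : ∫⁻ y, ENNReal.ofReal (a y) * ‖φ y‖ₑ ∂(weight α) ≠ ∞ :=
    ne_top_of_le_ne_top ENNReal.ofReal_ne_top (le_add_self.trans h)
  refine ⟨hfin, ?_⟩
  have hnn : 0 ≤ (lam - α * C) * ‖φ‖ := mul_nonneg (by linarith) (norm_nonneg _)
  have h2 := ENNReal.toReal_mono ENNReal.ofReal_ne_top h
  rwa [ENNReal.toReal_add ENNReal.ofReal_ne_top hfin, ENNReal.toReal_ofReal hnn,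
    ENNReal.toReal_ofReal (norm_nonneg _)] at h2

theorem IsFragKernel.norm_fragmentation_le (K : IsFragKernel a b) {θ M c : ℝ≥0}
    (hM : ∀ y, 0 < y → momentRatio α b y ≤ M)
    (hθ : ∀ y, 0 < y → (c : ℝ) ≤ a y → momentRatio α b y ≤ θ)
    (φ : (fragmentation 𝕜 α a b).domain)
    (hfin : ∫⁻ y, ENNReal.ofReal (a y) * ‖(φ : X₀ 𝕜 α) y‖ₑ ∂(weight α) ≠ ∞) :
    ‖fragmentation 𝕜 α a b φ‖ ≤ θ * absorption a (φ : X₀ 𝕜 α) + c * M * ‖(φ : X₀ 𝕜 α)‖ := by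
  have h := ENNReal.toReal_mono ?_ (K.ofReal_norm_fragmentation_le hM hθ φ)
  · rw [ENNReal.toReal_ofReal (norm_nonneg _), ENNReal.toReal_add
      (ENNReal.mul_ne_top ENNReal.coe_ne_top hfin) (ENNReal.mul_ne_top (ENNReal.mul_ne_top
        ENNReal.coe_ne_top ENNReal.coe_ne_top) ENNReal.ofReal_ne_top), ENNReal.toReal_mul,
      ENNReal.toReal_mul, ENNReal.toReal_mul, ENNReal.toReal_ofReal (norm_nonneg _)] at h
    exact h
  · exact ENNReal.add_ne_top.2 ⟨ENNReal.mul_ne_top ENNReal.coe_ne_top hfin, ENNReal.mul_ne_top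
      (ENNReal.mul_ne_top ENNReal.coe_ne_top ENNReal.coe_ne_top) ENNReal.ofReal_ne_top⟩

theorem generator_domain_le (F : IsFlow r a s A C) (K : IsFragKernel a b) (hα : 0 ≤ α) {M : ℝ≥0}
    (hM : ∀ y, 0 < y → momentRatio α b y ≤ M) :
    (F.semigroup 𝕜 hα).generator.domain ≤ (fragmentation 𝕜 α a b).domain := by
  rintro φ ⟨ψ, hψ⟩
  exact K.inFragDomain hM (F.absorption_bound hα (lt_add_one (α * C)) hψ).1

/-- `R` is the resolvent of the transport generator at `λ`, and `Q = B R`. -/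
structure IsFragResolvent (F : IsFlow r a s A C) (hα : 0 ≤ α) (b : ℝ → ℝ → ℝ) (lam : ℝ)
    (R Q : X₀ 𝕜 α →L[𝕜] X₀ 𝕜 α) : Prop where
  laplace : ∀ f, R f = (F.semigroup 𝕜 hα).laplace lam f
  isResolventAt : IsResolventAt (F.semigroup 𝕜 hα).generator (lam : 𝕜) R
  frag : ∀ f, ∃ h : R f ∈ (fragmentation 𝕜 α a b).domain, fragmentation 𝕜 α a b ⟨R f, h⟩ = Q f

theorem IsFlow.resolvent_bound (F : IsFlow r a s A C) (hα : 0 ≤ α) {lam : ℝ} (hlam : α * C < lam)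
    {R : X₀ 𝕜 α →L[𝕜] X₀ 𝕜 α} (hR : IsResolventAt (F.semigroup 𝕜 hα).generator (lam : 𝕜) R)
    (f : X₀ 𝕜 α) :
    ∫⁻ y, ENNReal.ofReal (a y) * ‖R f y‖ₑ ∂(weight α) ≠ ∞ ∧
      (lam - α * C) * ‖R f‖ + absorption a (R f) ≤ ‖f‖ := by
  have h := F.absorption_bound hα hlam
    ((F.semigroup 𝕜 hα).generator_hasGenerator ⟨R f, hR.mem_domain f⟩)
  rwa [hR.eq_sub, sub_sub_cancel] at h

theorem exists_isFragResolvent (F : IsFlow r a s A C) (K : IsFragKernel a b) (hα : 0 ≤ α) {M : ℝ≥0}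
    (hM : ∀ y, 0 < y → momentRatio α b y ≤ M) {lam : ℝ} (hlam : α * C < lam) :
    ∃ R Q : X₀ 𝕜 α →L[𝕜] X₀ 𝕜 α, IsFragResolvent F hα b lam R Q := by
  obtain ⟨R, hR1, hR2⟩ := C0Semigroup.exists_resolvent (S := F.semigroup 𝕜 hα)
    (F.norm_transportOp_le hα) hlam
  have hdom : ∀ f, R f ∈ (fragmentation 𝕜 α a b).domain := fun f =>
    generator_domain_le F K hα hM (hR2.mem_domain f)
  let Q : X₀ 𝕜 α →L[𝕜] X₀ 𝕜 α := LinearMap.mkContinuous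
    ((fragmentation 𝕜 α a b).toFun.comp ((R : X₀ 𝕜 α →ₗ[𝕜] X₀ 𝕜 α).codRestrict _ hdom)) M
    fun f => by
      have h1 := F.resolvent_bound hα hlam hR2 f
      have h2 := K.norm_fragmentation_le (θ := M) (c := 0) hM (fun y hy _ => hM y hy)
        ⟨R f, hdom f⟩ h1.1
      have h3 : 0 ≤ (lam - α * C) * ‖R f‖ := mul_nonneg (by linarith) (norm_nonneg _)
      refine h2.trans ?_
      simp only [NNReal.coe_zero, zero_mul, add_zero]
      gcongr
      linarith [h1.2]
  exact ⟨R, Q, hR1, hR2, fun f => ⟨hdom f, rfl⟩⟩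

theorem IsFlow.preservesDomination_transportOp (F : IsFlow r a s A C) (hα : 0 ≤ α)
    (t : ℝ≥0) : PreservesDomination (F.transportOp 𝕜 hα t) := by
  intro f g h
  filter_upwards [F.coeFn_transportOp hα t f, F.coeFn_transportOp hα t g,
    F.ae_flow_neg t.coe_nonneg h, ae_weight_pos α] with y h1 h2 h3 hy
  rw [h1, h2]
  simp only [transport]
  split_ifs with hty
  · have hX : 0 < flow s (-(t : ℝ)) y := F.flow_pos (by linarith)
    have hpos : 0 ≤ Real.exp (-(A y - A (flow s (-(t : ℝ)) y))) * (r (flow s (-(t : ℝ)) y) / r y) :=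
      mul_nonneg (Real.exp_pos _).le (div_pos (F.r_pos _ hX) (F.r_pos y hy)).le
    rw [norm_mul, RCLike.norm_ofReal, abs_of_nonneg hpos, RCLike.re_ofReal_mul]
    exact mul_le_mul_of_nonneg_left (h3 hty) hpos
  · simp

namespace IsFragResolvent

variable {F : IsFlow r a s A C} {hα : 0 ≤ α} {lam : ℝ} {R Q : X₀ 𝕜 α →L[𝕜] X₀ 𝕜 α}

/-- The key estimate bounds both terms of `θ ‖a φ‖ + c M ‖φ‖`, the second with weight `λ - α C`. -/
theorem norm_le (h : IsFragResolvent F hα b lam R Q) (K : IsFragKernel a b)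
    (hlam : α * C < lam) {θ M c : ℝ≥0} (hM : ∀ y, 0 < y → momentRatio α b y ≤ M)
    (hθ : ∀ y, 0 < y → (c : ℝ) ≤ a y → momentRatio α b y ≤ θ) :
    ‖Q‖ ≤ max (θ : ℝ) (c * M / (lam - α * C)) := by
  set q := max (θ : ℝ) (c * M / (lam - α * C)) with hq
  have hq0 : 0 ≤ q := θ.coe_nonneg.trans (le_max_left _ _)
  have hl : 0 < lam - α * C := sub_pos.2 hlam
  refine ContinuousLinearMap.opNorm_le_bound _ hq0 fun f => ?_
  obtain ⟨hd, e⟩ := h.frag f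
  have h1 := F.resolvent_bound hα hlam h.isResolventAt f
  have h2 := K.norm_fragmentation_le hM hθ ⟨R f, hd⟩ h1.1
  rw [e] at h2
  have h3 : (c * M : ℝ) ≤ q * (lam - α * C) := (div_le_iff₀ hl).1 (le_max_right _ _)
  calc ‖Q f‖ ≤ θ * absorption a (R f) + c * M * ‖R f‖ := h2
    _ ≤ q * absorption a (R f) + q * (lam - α * C) * ‖R f‖ := by
        gcongr
        · exact absorption_nonneg _ _
        · exact le_max_left _ _
    _ = q * ((lam - α * C) * ‖R f‖ + absorption a (R f)) := by ring
    _ ≤ q * ‖f‖ := by gcongr; exact h1.2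

theorem isDominated (h : IsFragResolvent F hα b lam R Q) {mu : ℝ} {R' Q' : X₀ 𝕜 α →L[𝕜] X₀ 𝕜 α}
    (h' : IsFragResolvent F hα b mu R' Q') (hlam : α * C < lam) (hmu : lam ≤ mu) {f g : X₀ 𝕜 α}
    (hfg : IsDominated f g) : IsDominated (R' f) (R g) := by
  have hf := C0Semigroup.integrableOn_damped (S := F.semigroup 𝕜 hα) (F.norm_transportOp_le hα)
    (hlam.trans_le hmu) f
  have hg := C0Semigroup.integrableOn_damped (S := F.semigroup 𝕜 hα) (F.norm_transportOp_le hα)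
    hlam g
  have key := integral_mem_properCone (dominationCone 𝕜 α) (hf.prodMk hg) (by
    filter_upwards [ae_restrict_mem measurableSet_Ioi] with t ht
    have ht0 : 0 < t := ht
    have h1 : Real.exp (-mu * t) ≤ Real.exp (-lam * t) := Real.exp_le_exp.2 (by nlinarith)
    have h2 := (F.preservesDomination_transportOp hα t.toNNReal f g hfg).smul_of_le
      (Real.exp_pos _).le h1
    rw [← RCLike.real_smul_eq_coe_smul, ← RCLike.real_smul_eq_coe_smul] at h2
    exact h2)
  rw [integral_pair hf hg] at key
  rw [h'.laplace, h.laplace]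
  exact key

theorem isDominated_frag (h : IsFragResolvent F hα b lam R Q) (K : IsFragKernel a b) {mu : ℝ}
    {R' Q' : X₀ 𝕜 α →L[𝕜] X₀ 𝕜 α} (h' : IsFragResolvent F hα b mu R' Q') (hlam : α * C < lam)
    (hmu : lam ≤ mu) {f g : X₀ 𝕜 α} (hfg : IsDominated f g) : IsDominated (Q' f) (Q g) := by
  obtain ⟨h1, e1⟩ := h'.frag f
  obtain ⟨h2, e2⟩ := h.frag g
  rw [← e1, ← e2]
  exact K.isDominated_fragmentation (φ := ⟨R' f, h1⟩) (ψ := ⟨R g, h2⟩)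
    (h.isDominated h' hlam hmu hfg)

/-- The norm of `B (λ - T)⁻¹` decreases in `λ`, since the norm of a positive operator is determined
by nonnegative functions. -/
theorem norm_anti (h : IsFragResolvent F hα b lam R Q) (K : IsFragKernel a b) {mu : ℝ}
    {R' Q' : X₀ 𝕜 α →L[𝕜] X₀ 𝕜 α} (h' : IsFragResolvent F hα b mu R' Q') (hlam : α * C < lam)
    (hmu : lam ≤ mu) : ‖Q'‖ ≤ ‖Q‖ := by
  refine ContinuousLinearMap.opNorm_le_bound _ (norm_nonneg _) fun f => ?_
  obtain ⟨g, hg, hgn⟩ := exists_isDominated_norm_eq f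
  rw [← hgn]
  exact (h.isDominated_frag K h' hlam hmu hg).norm_le.trans (Q.le_opNorm g)

/-- The resolvent of `T + B` as the Neumann series `R Σ (B R)^n`. -/
theorem isResolventAt_neumann (h : IsFragResolvent F hα b lam R Q) (hQ : ‖Q‖ < 1) :
    IsResolventAt ((F.semigroup 𝕜 hα).generator + fragmentation 𝕜 α a b) (lam : 𝕜)
      (R * ∑' n, Q ^ n) := by
  have e1 : (∑' n, Q ^ n) * (1 - Q) = 1 := geom_series_mul_neg Q hQ
  have e2 : (1 - Q) * (∑' n, Q ^ n) = 1 := mul_neg_geom_series Q hQ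
  set G := ∑' n, Q ^ n
  refine ⟨fun f => ?_, fun φ => ?_⟩
  · obtain ⟨h1, h2⟩ := h.frag (G f)
    refine ⟨⟨h.isResolventAt.mem_domain (G f), h1⟩, ?_⟩
    have h3 := DFunLike.congr_fun e2 f
    rw [LinearPMap.add_apply]
    simp only [mul_apply_eq_comp, h.isResolventAt.eq_sub, h2] at h3 ⊢
    simp only [sub_apply, one_apply_eq_self] at h3
    rw [← sub_sub, sub_sub_cancel]
    exact h3
  · obtain ⟨φ, hφ1, hφ2⟩ := φ
    set g : X₀ 𝕜 α := (lam : 𝕜) • φ - (F.semigroup 𝕜 hα).generator ⟨φ, hφ1⟩ with hg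
    have hRg : R g = φ := h.isResolventAt.2 ⟨φ, hφ1⟩
    have hQg : fragmentation 𝕜 α a b ⟨φ, hφ2⟩ = Q g := by
      obtain ⟨h1, h2⟩ := h.frag g
      rw [← h2]
      simp only [hRg]
    have h3 := DFunLike.congr_fun e1 g
    rw [LinearPMap.add_apply]
    simp only [hQg]
    rw [← sub_sub, ← hg]
    simp only [mul_apply_eq_comp, sub_apply, one_apply_eq_self] at h3 ⊢
    rw [h3, hRg]

theorem preservesDomination_neumann (h : IsFragResolvent F hα b lam R Q) (K : IsFragKernel a b)
    (hlam : α * C < lam) (hQ : ‖Q‖ < 1) : PreservesDomination (R * ∑' n, Q ^ n) := by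
  have hR : PreservesDomination R := fun f g hfg => h.isDominated h hlam le_rfl hfg
  have hQd : PreservesDomination Q := fun f g hfg => h.isDominated_frag K h hlam le_rfl hfg
  refine hR.mul (PreservesDomination.of_tendsto (L := fun n => ∑ i ∈ Finset.range n, Q ^ i)
    (fun n => PreservesDomination.sum _ fun i => hQd.pow i) fun f => ?_)
  have hs := (summable_geometric_of_norm_lt_one hQ).hasSum.tendsto_sum_nat
  exact ((ContinuousLinearMap.apply 𝕜 (X₀ 𝕜 α) f).continuous.tendsto _).comp hs

/-- Dissipativity of `T + B`: where `a ≥ c` the fragmentation gain is at most the absorption, and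
elsewhere it is a bounded perturbation. -/
theorem norm_resolvent_add_le (F : IsFlow r a s A C) (hα : 0 ≤ α) (K : IsFragKernel a b)
    {M c : ℝ≥0} (hM : ∀ y, 0 < y → momentRatio α b y ≤ M)
    (hc : ∀ y, 0 < y → (c : ℝ) ≤ a y → momentRatio α b y ≤ (1 : ℝ≥0))
    (hlam : α * C + c * M < lam) {P : X₀ 𝕜 α →L[𝕜] X₀ 𝕜 α}
    (hP : IsResolventAt ((F.semigroup 𝕜 hα).generator + fragmentation 𝕜 α a b) (lam : 𝕜) P) :
    ‖P‖ ≤ (lam - (α * C + c * M))⁻¹ := by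
  have hl : 0 < lam - (α * C + c * M) := sub_pos.2 hlam
  have hcM : (0 : ℝ) ≤ c * M := by positivity
  refine ContinuousLinearMap.opNorm_le_bound _ (inv_pos.2 hl).le fun f => ?_
  rw [← div_eq_inv_mul, le_div_iff₀ hl]
  obtain ⟨⟨hd1, hd2⟩, e⟩ := hP.1 f
  rw [LinearPMap.add_apply] at e
  simp only at e
  have h1 := F.absorption_bound hα (show α * C < lam by linarith)
    ((F.semigroup 𝕜 hα).generator_hasGenerator ⟨P f, hd1⟩)
  have h2 := K.norm_fragmentation_le (θ := 1) hM hc ⟨P f, hd2⟩ h1.1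
  have h3 : (lam : 𝕜) • P f - (F.semigroup 𝕜 hα).generator ⟨P f, hd1⟩ =
      f + fragmentation 𝕜 α a b ⟨P f, hd2⟩ := by
    rw [← sub_eq_iff_eq_add, sub_sub, e]
  have h4 := h1.2
  rw [h3] at h4
  have h5 := norm_add_le f (fragmentation 𝕜 α a b ⟨P f, hd2⟩)
  simp only [NNReal.coe_one, one_mul] at h2
  nlinarith

end IsFragResolvent

theorem exists_threshold_of_limsupRatio_lt {θ : ℝ≥0∞} (h : limsupRatio α a b < θ) :
    ∃ c : ℝ≥0, ∀ y, 0 < y → (c : ℝ) ≤ a y → momentRatio α b y ≤ θ := by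
  have h1 := eventually_lt_of_limsup_lt h
  rw [eventually_inf_principal, eventually_comap, eventually_atTop] at h1
  obtain ⟨c, hc⟩ := h1
  exact ⟨c.toNNReal, fun y hy hcy =>
    (hc (a y) ((Real.le_coe_toNNReal c).trans hcy) y rfl hy).le⟩

theorem isRelativelyBounded_fragmentation (F : IsFlow r a s A C) (K : IsFragKernel a b) (hα : 0 ≤ α)
    {M : ℝ≥0} (hM : ∀ y, 0 < y → momentRatio α b y ≤ M) :
    IsRelativelyBounded (F.semigroup 𝕜 hα).generator (fragmentation 𝕜 α a b) := by
  have hC := mul_nonneg hα F.C_pos.le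
  have hdom := generator_domain_le (𝕜 := 𝕜) F K hα hM
  refine ⟨hdom, M, M * (α * C + 1), by positivity, by positivity, fun ⟨φ, hφ⟩ => ?_⟩
  set ψ : X₀ 𝕜 α := (F.semigroup 𝕜 hα).generator ⟨φ, hφ⟩ with hψ
  have h1 := F.absorption_bound hα (lt_add_one (α * C))
    ((F.semigroup 𝕜 hα).generator_hasGenerator ⟨φ, hφ⟩)
  rw [← hψ] at h1
  have h2 := K.norm_fragmentation_le (θ := M) (c := 0) hM (fun y hy _ => hM y hy)
    ⟨φ, hdom hφ⟩ h1.1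
  have h3 : ‖((α * C + 1 : ℝ) : 𝕜) • φ - ψ‖ ≤ (α * C + 1) * ‖φ‖ + ‖ψ‖ := by
    refine (norm_sub_le _ _).trans_eq ?_
    rw [norm_smul, RCLike.norm_ofReal, abs_of_nonneg (by positivity)]
  have h4 : absorption a φ ≤ (α * C + 1) * ‖φ‖ + ‖ψ‖ := by
    have := norm_nonneg φ
    have h5 := h1.2
    simp only [add_sub_cancel_left, one_mul] at h5
    linarith
  simp only [NNReal.coe_zero, zero_mul, add_zero] at h2
  refine h2.trans ((mul_le_mul_of_nonneg_left h4 M.coe_nonneg).trans_eq ?_)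
  ring

theorem exists_limit_norm_fragResolvent (F : IsFlow r a s A C) (K : IsFragKernel a b) (hα : 0 ≤ α)
    {M : ℝ≥0} (hM : ∀ y, 0 < y → momentRatio α b y ≤ M) :
    ∃ (R Q : ℝ → (X₀ 𝕜 α →L[𝕜] X₀ 𝕜 α)) (l : ℝ),
      (∀ᶠ lam : ℝ in atTop, IsFragResolvent F hα b lam (R lam) (Q lam)) ∧
      Tendsto (fun lam => ‖Q lam‖) atTop (𝓝 l) ∧ ENNReal.ofReal l ≤ limsupRatio α a b := by
  have hex : ∀ lam : ℝ, ∃ R Q : X₀ 𝕜 α →L[𝕜] X₀ 𝕜 α,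
      IsFragResolvent F hα b (max lam (α * C + 1)) R Q := fun lam =>
    exists_isFragResolvent F K hα hM ((lt_add_one _).trans_le (le_max_right _ _))
  choose R Q hRQ using hex
  have hlt : ∀ lam : ℝ, α * C < max lam (α * C + 1) := fun lam =>
    (lt_add_one _).trans_le (le_max_right _ _)
  have hanti : Antitone fun lam => ‖Q lam‖ := fun lam mu h =>
    (hRQ lam).norm_anti K (hRQ mu) (hlt lam) (max_le_max_right _ h)
  have hlim := tendsto_atTop_ciInf hanti ⟨0, by rintro _ ⟨lam, rfl⟩; exact norm_nonneg _⟩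
  have hev : ∀ᶠ lam : ℝ in atTop, IsFragResolvent F hα b lam (R lam) (Q lam) := by
    filter_upwards [eventually_ge_atTop (α * C + 1)] with lam hl
    have := hRQ lam
    rwa [max_eq_left hl] at this
  refine ⟨R, Q, _, hev, hlim, le_of_forall_gt fun θ hθ => ?_⟩
  obtain ⟨θ', hθ1, hθ2⟩ := exists_between hθ
  lift θ' to ℝ≥0 using hθ2.ne_top
  obtain ⟨c, hc⟩ := exists_threshold_of_limsupRatio_lt hθ1
  refine lt_of_le_of_lt ?_ hθ2
  rw [← ENNReal.ofReal_coe_nnreal]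
  refine ENNReal.ofReal_le_ofReal ?_
  have hb : Tendsto (fun lam : ℝ => max (θ' : ℝ) (c * M / (lam - α * C))) atTop (𝓝 θ') := by
    have h0 : Tendsto (fun lam : ℝ => (c * M : ℝ) / (lam - α * C)) atTop (𝓝 0) :=
      tendsto_const_nhds.div_atTop (tendsto_atTop_add_const_right _ _ tendsto_id)
    simpa using (tendsto_const_nhds (x := (θ' : ℝ))).max h0
  refine le_of_tendsto_of_tendsto hlim hb ?_
  filter_upwards [hev, eventually_gt_atTop (α * C)] with lam h1 h2
  exact h1.norm_le K h2 hM hc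

theorem exists_positive_semigroup (F : IsFlow r a s A C) (K : IsFragKernel a b) (hα : 0 ≤ α)
    {M : ℝ≥0} (hM : ∀ y, 0 < y → momentRatio α b y ≤ M) (hlt : limsupRatio α a b < 1) :
    ∃ V : C0Semigroup 𝕜 (X₀ 𝕜 α), IsPositive V ∧
      V.generator = (F.semigroup 𝕜 hα).generator + fragmentation 𝕜 α a b := by
  obtain ⟨θ, hθ1, hθ2⟩ := exists_between hlt
  lift θ to ℝ≥0 using hθ2.ne_top
  obtain ⟨c, hc⟩ := exists_threshold_of_limsupRatio_lt hθ1
  have hθ : (θ : ℝ) < 1 := by exact_mod_cast hθ2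
  set ω : ℝ := α * C + c * M with hω
  have hC := mul_nonneg hα F.C_pos.le
  have hcM : (0 : ℝ) ≤ c * M := by positivity
  have hex : ∀ lam : ℝ, ω < lam → ∃ P : X₀ 𝕜 α →L[𝕜] X₀ 𝕜 α,
      IsResolventAt ((F.semigroup 𝕜 hα).generator + fragmentation 𝕜 α a b) (lam : 𝕜) P ∧
        PreservesDomination P := by
    intro lam hlam
    have hl : α * C < lam := by linarith
    obtain ⟨R, Q, h⟩ := exists_isFragResolvent (𝕜 := 𝕜) F K hα hM hl
    have hQ : ‖Q‖ < 1 := by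
      refine (h.norm_le K hl hM hc).trans_lt (max_lt hθ ?_)
      rw [div_lt_one (sub_pos.2 hl)]
      linarith
    exact ⟨_, h.isResolventAt_neumann hQ, h.preservesDomination_neumann K hl hQ⟩
  choose! P hP1 hP2 using hex
  have hdense : Dense (((F.semigroup 𝕜 hα).generator + fragmentation 𝕜 α a b).domain :
      Set (X₀ 𝕜 α)) := by
    have e : ((F.semigroup 𝕜 hα).generator + fragmentation 𝕜 α a b).domain =
        (F.semigroup 𝕜 hα).generator.domain := inf_eq_left.2 (generator_domain_le F K hα hM)
    rw [e]
    exact C0Semigroup.dense_domain (F.norm_transportOp_le hα)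
  have hc1 : ∀ y, 0 < y → (c : ℝ) ≤ a y → momentRatio α b y ≤ (1 : ℝ≥0) := fun y hy hcy =>
    (hc y hy hcy).trans hθ2.le
  obtain ⟨V, hV, hVlim⟩ := hilleYosida (add_nonneg hC hcM) hdense hP1 fun lam hlam =>
    IsFragResolvent.norm_resolvent_add_le F hα K hM hc1 hlam (hP1 lam hlam)
  refine ⟨V, fun t f hf => ?_, hV⟩
  have hVd : PreservesDomination (V.op t) := by
    refine PreservesDomination.of_tendsto (fun n => ?_) (hVlim t)
    have hn : (0 : ℝ) < n + 1 := by positivity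
    exact PreservesDomination.expOp ((hP2 _ (by linarith)).smul (by positivity)) _ t.coe_nonneg
  rw [isNonneg_iff_isDominated] at hf ⊢
  exact hVd f f hf

end Perturbation

end GrowthFrag

end

open GrowthFrag in
theorem mainTheorem4 {𝕜 : Type*} [RCLike 𝕜] (α : ℝ) (hα : 0 < α)
    (r a : ℝ → ℝ) (b : ℝ → ℝ → ℝ)
    -- the growth rate
    (hr_cont : ContinuousOn r (Ioi 0)) (hr_pos : ∀ x, 0 < x → 0 < r x)
    (hr_zero : IntegrableOn (fun τ => 1 / r τ) (Ioc 0 1))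
    (hr_top : ¬ IntegrableOn (fun τ => 1 / r τ) (Ioi 1))
    (hr_lin : ∃ C : ℝ, 0 < C ∧ ∀ z, 0 < z → r z ≤ C * (z + 1))
    -- the total fragmentation rate
    (ha_loc : LocallyIntegrableOn a (Ioi 0)) (ha_nonneg : ∀ y, 0 < y → 0 ≤ a y)
    -- the fragmentation kernel
    (hb_meas : AEMeasurable (fun p : ℝ × ℝ => b p.1 p.2)
      (volume.restrict (Ioi (0 : ℝ) ×ˢ Ioi (0 : ℝ))))
    (hb_nonneg : ∀ x y, 0 < x → 0 < y → 0 ≤ b x y)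
    (hb_zero : ∀ x y, 0 < y → y ≤ x → b x y = 0)
    (hb_mass : ∀ y, 0 < y → ∫ x in Ioo 0 y, x * b x y = y) :
    ∃ U : C0Semigroup 𝕜 (X₀ 𝕜 α),
      (∀ (t : ℝ≥0) (f : X₀ 𝕜 α), IsTransported r a t f (U.op t f)) ∧
      ((∃ M : ℝ≥0, ∀ y, 0 < y → momentRatio α b y ≤ M) →
        IsRelativelyBounded U.generator (fragmentation 𝕜 α a b) ∧
        (∃ (R K : ℝ → (X₀ 𝕜 α →L[𝕜] X₀ 𝕜 α)) (l : ℝ),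
          (∀ᶠ lam : ℝ in atTop,
            IsResolventAt U.generator (lam : 𝕜) (R lam) ∧
            ∀ f, ∃ h : R lam f ∈ (fragmentation 𝕜 α a b).domain,
              fragmentation 𝕜 α a b ⟨R lam f, h⟩ = K lam f) ∧
          Tendsto (fun lam => ‖K lam‖) atTop (𝓝 l) ∧
          ENNReal.ofReal l ≤ limsupRatio α a b) ∧
        (limsupRatio α a b < 1 →
          ∃ V : C0Semigroup 𝕜 (X₀ 𝕜 α),
            IsPositive V ∧ V.generator = U.generator + fragmentation 𝕜 α a b)) := by

  obtain ⟨s, hs0, hsi, hsd⟩ := exists_travelTime hr_cont hr_pos hr_zero hr_top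
  obtain ⟨A, hAc, hAm, hAi, hAd⟩ := exists_loss hr_cont hr_pos ha_loc ha_nonneg
  obtain ⟨C, -, hC⟩ := hr_lin
  have F : IsFlow r a s A C :=
    { r_cont := hr_cont
      r_pos := hr_pos
      r_le := fun x hx => by rw [add_comm]; exact hC x hx
      a_meas := ha_loc.aestronglyMeasurable.aemeasurable
      a_nonneg := ha_nonneg
      time_zero := hs0
      time_integral := hsi
      time_deriv := hsd
      loss_cont := hAc
      loss_mono := hAm
      loss_integral := hAi
      loss_deriv := hAd }
  have K : IsFragKernel a b := ⟨F.a_meas, ha_nonneg, hb_meas, hb_nonneg, hb_zero⟩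
  refine ⟨F.semigroup 𝕜 hα.le, F.isTransported hα.le, fun ⟨M, hM⟩ => ⟨?_, ?_, fun hlt => ?_⟩⟩
  · exact isRelativelyBounded_fragmentation F K hα.le hM
  · obtain ⟨R, Q, l, hRQ, hlim, hl⟩ := exists_limit_norm_fragResolvent (𝕜 := 𝕜) F K hα.le hM
    exact ⟨R, Q, l, hRQ.mono fun lam h => ⟨h.isResolventAt, h.frag⟩, hlim, hl⟩
  · exact exists_positive_semigroup F K hα.le hM hlt
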